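/- There exist universal constants $C,c>0$ such that the following is true. Let $n\in\mathbb{N}$, $n\ge 1$, $p\in[1,\infty)$, $\varepsilon\in(0,1)$, and let $Z$ be a random vector in $\mathbb{R}^{n}$ with the standard normal distribution. Write $|x|_p=\left(\sum_{i=1}^n|x_i|^p\right)^{1/p}$ for $x\in\mathbb{R}^n$. Then $|Z|_p$ is integrable, and $$ \mathbb{P}\left\{ (1-\varepsilon)\,\mathbb{E}|Z|_p\le |Z|_p\le (1+\varepsilon)\,\mathbb{E}|Z|_p\right\}\ \ge\ \begin{cases} 1-C\exp\left(-cn\varepsilon^{2}\right) & : 1\le p\le 2,\\ 1-C\exp\left(-c\min\left\{p\,8^{-p}n\varepsilon^{2},\ p\,n^{2/p}\varepsilon^{2/p}\right\}\right) & : 2\le p<c\log n,\\ 1-Cn^{-c\varepsilon} & : p\ge c\log n, \end{cases} $$ where, if $p$ satisfies several of the conditions on the right, each of the corresponding bounds holds. -/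

import Mathlib

open MeasureTheory ProbabilityTheory

/-- The `ℓ_p^n` norm `|x|_p` of a vector `x` of `ℝ^n`, for a real exponent `p`: Mathlib's `PiLp`
norm of the vector with the same coordinates. -/
noncomputable def ellNorm {n : ℕ} (p : ℝ) (x : EuclideanSpace ℝ (Fin n)) : ℝ :=
  ‖(WithLp.toLp (ENNReal.ofReal p) (fun i => x i) :
    PiLp (ENNReal.ofReal p) (fun _ : Fin n => ℝ))‖

/-- The explicit formula for the `ℓ_p^n` norm. -/
theorem ellNorm_eq {n : ℕ} {p : ℝ} (hp : 0 < p) (x : EuclideanSpace ℝ (Fin n)) :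
    ellNorm p x = (∑ i, |x i| ^ p) ^ (1 / p) := by
  have h : (ENNReal.ofReal p).toReal = p := ENNReal.toReal_ofReal hp.le
  unfold ellNorm
  rw [PiLp.norm_eq_sum (by rw [h]; exact hp), h]
  simp only [Real.norm_eq_abs]

/-! Write `S = ∑ |x i| ^ p` for standard normal coordinates, `m = E|Z|^p`, `η = exp (-5)`. The
constants are `C = 8`, `c = η / 2048`.

For `p ≤ 2` and for `2 ≤ p < (η / 16) log n` the norm follows `S`. Since `E|Z|^{2p} ≤ 2^p m²`
(`absMoment_two_mul_le`), Chebyshev-type bounds put the mean of the norm between `(1 - ε/4) (n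
m)^{1/p}` and `(n m)^{1/p}` as soon as `16 · 2^p ≤ n ε²`; otherwise the claim is void. The lower
tail of `S` is sub-Gaussian because its terms are nonnegative (`measureReal_sum_le_sub`). The upper
tail is a Chernoff bound, direct for `p ≤ 2` because `|x|^p ≤ 1 + x²`, and after truncation for `p ≥
2` (`measureReal_le_sum_absPow_of_two_le`).

For `p ≥ a log n` the maximum may dominate `S`. With `b` the quantile `n P(|Z| > b) = 1`, the right
scale is `D^{1/p}`, where `D = b^p + n E(|Z|^p; |Z| ≤ b)`. The ratio `Y` of the norm to this scale
has bounded moment of order `q = a log n` (`integral_sum_absPow_div_rpow_le`) and an exponential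
lower tail of rate proportional to `q` (`measureReal_sum_absPow_lt_le`). Both fluctuations of `Y`
and the distance of its mean from `1` are then of order `1 / log n`.

As `c` is both a rate and the threshold on `p / log n`, a window `c log n ≤ p < (η / 16) log n`
remains; there the bound for moderate `p` is strong enough to imply the one for large `p`. -/

/-! ### Exponential and second moment bounds for sums of independent copies. -/

section IidSums

variable {α : Type*} [MeasurableSpace α] {ν : Measure α} [IsProbabilityMeasure ν] {n : ℕ}

theorem integrable_exp_sum_pi {g : α → ℝ} (hg : Integrable (fun t => Real.exp (g t)) ν) :
    Integrable (fun x : Fin n → α => Real.exp (∑ i, g (x i))) (Measure.pi fun _ => ν) := by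
  simp_rw [Real.exp_sum]
  exact Integrable.fintype_prod (f := fun (_ : Fin n) t => Real.exp (g t)) (fun _ => hg)

theorem integral_exp_sum_pi (g : α → ℝ) :
    ∫ x : Fin n → α, Real.exp (∑ i, g (x i)) ∂(Measure.pi fun _ => ν)
      = (∫ t, Real.exp (g t) ∂ν) ^ n := by
  simp_rw [Real.exp_sum]
  rw [integral_fintype_prod_eq_pow (fun t => Real.exp (g t))]
  simp

theorem integral_sum_comp_eval {g : α → ℝ} (hg : Integrable g ν) :
    ∫ x : Fin n → α, ∑ i, g (x i) ∂(Measure.pi fun _ => ν) = n * ∫ t, g t ∂ν := by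
  rw [integral_finsetSum _ (fun i _ => integrable_comp_eval (μ := fun _ : Fin n => ν) (i := i) hg)]
  have (i : Fin n) : ∫ x : Fin n → α, g (x i) ∂(Measure.pi fun _ => ν) = ∫ t, g t ∂ν :=
    integral_comp_eval (μ := fun _ : Fin n => ν) (i := i) hg.aestronglyMeasurable
  simp [this]

theorem integrable_sum_comp_eval {g : α → ℝ} (hg : Integrable g ν) :
    Integrable (fun x : Fin n → α => ∑ i, g (x i)) (Measure.pi fun _ => ν) :=
  integrable_finsetSum _ fun i _ => integrable_comp_eval (μ := fun _ : Fin n => ν) (i := i) hg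

/-- Chernoff's bound for a sum of independent copies. -/
theorem measureReal_le_sum_le {g : α → ℝ} (hg : Integrable (fun t => Real.exp (g t)) ν) {A : ℝ}
    (hA : ∫ t, Real.exp (g t) ∂ν ≤ Real.exp A) (y : ℝ) :
    (Measure.pi fun _ => ν).real {x : Fin n → α | y ≤ ∑ i, g (x i)} ≤ Real.exp (-y + n * A) := by
  have h := measure_ge_le_exp_mul_mgf (μ := Measure.pi fun _ : Fin n => ν)
    (X := fun x => ∑ i, g (x i)) (t := 1) y zero_le_one
    (by simpa using integrable_exp_sum_pi hg)
  refine h.trans ?_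
  simp only [mgf, one_mul]
  rw [integral_exp_sum_pi, Real.exp_add, neg_one_mul, Real.exp_nat_mul]
  gcongr

/-- The product `(1 - y + y²/2)(1 + y + y²/2)` equals `1 + y⁴/4`, and the second factor is at most
`exp y`. -/
theorem exp_neg_le_quadratic {y : ℝ} (hy : 0 ≤ y) : Real.exp (-y) ≤ 1 - y + y ^ 2 / 2 := by
  have h1 := Real.quadratic_le_exp_of_nonneg hy
  have h2 : Real.exp (-y) * Real.exp y = 1 := by rw [← Real.exp_add]; simp
  have h3 := Real.exp_pos (-y)
  have h4 : 0 < 1 - y + y ^ 2 / 2 := by nlinarith [sq_nonneg (y - 1)]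
  have h5 : Real.exp (-y) * (1 + y + y ^ 2 / 2) ≤ 1 := 
    (mul_le_mul_of_nonneg_left h1 h3.le).trans_eq h2
  have h6 : 1 ≤ (1 - y + y ^ 2 / 2) * (1 + y + y ^ 2 / 2) := by nlinarith [sq_nonneg (y ^ 2)]
  have h7 : 0 < 1 + y + y ^ 2 / 2 := by positivity
  exact le_of_mul_le_mul_right (h5.trans h6) h7

/-- From `1 - y ≤ exp (-y)` one gets `exp y ≤ 1 + y * exp y`; inserting this bound into its own
right side gives the claim. -/
theorem exp_le_one_add_add_sq_mul_exp {y : ℝ} (hy : 0 ≤ y) :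
    Real.exp y ≤ 1 + y + y ^ 2 * Real.exp y := by
  have h1 := Real.add_one_le_exp (-y)
  have h2 : Real.exp (-y) * Real.exp y = 1 := by rw [← Real.exp_add]; simp
  nlinarith [mul_le_mul_of_nonneg_right h1 (Real.exp_pos y).le]

/-- The lower tail of a sum of independent nonnegative variables is sub-Gaussian. -/
theorem measureReal_sum_le_sub {g : α → ℝ} (hg0 : ∀ t, 0 ≤ g t) (hg : Integrable g ν)
    (hg2 : Integrable (fun t => g t ^ 2) ν) {v : ℝ} (hv : ∫ t, g t ^ 2 ∂ν ≤ v) (hv0 : 0 < v)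
    (hn : 1 ≤ n) {y : ℝ} (hy : 0 ≤ y) :
    (Measure.pi fun _ => ν).real {x : Fin n → α | ∑ i, g (x i) ≤ n * (∫ t, g t ∂ν) - y}
      ≤ Real.exp (-(y ^ 2 / (2 * n * v))) := by
  have hn' : (0 : ℝ) < n := by exact_mod_cast hn
  -- This is the minimiser of the Chernoff exponent `-l y + n l² v / 2`.
  set l : ℝ := y / (n * v) with hl
  have hl0 : 0 ≤ l := by positivity
  have hint : Integrable (fun t => Real.exp (-l * g t)) ν := by
    refine Integrable.mono' (integrable_const (1 : ℝ)) ?_ ?_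
    · exact (Real.continuous_exp.comp_aestronglyMeasurable (hg.aestronglyMeasurable.const_mul _))
    · refine Filter.Eventually.of_forall fun t => ?_
      rw [Real.norm_eq_abs, Real.abs_exp, Real.exp_le_one_iff]
      nlinarith [hg0 t]
  have hmgf : ∫ t, Real.exp (-l * g t) ∂ν ≤ Real.exp (-l * (∫ t, g t ∂ν) + l ^ 2 * v / 2) := by
    have h1 : ∫ t, Real.exp (-l * g t) ∂ν ≤ ∫ t, (1 - l * g t + l ^ 2 / 2 * g t ^ 2) ∂ν := by
      refine integral_mono hint
        (((integrable_const _).sub (hg.const_mul _)).add (hg2.const_mul _)) fun t => ?_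
      have := exp_neg_le_quadratic (mul_nonneg hl0 (hg0 t))
      simp only [neg_mul]
      nlinarith
    have h2 : ∫ t, (1 - l * g t + l ^ 2 / 2 * g t ^ 2) ∂ν
        = 1 - l * (∫ t, g t ∂ν) + l ^ 2 / 2 * ∫ t, g t ^ 2 ∂ν := by
      rw [integral_add (by fun_prop) (by fun_prop), integral_sub (by fun_prop) (by fun_prop), integral_const_mul, integral_const_mul]
      simp
    have h3 : l ^ 2 / 2 * ∫ t, g t ^ 2 ∂ν ≤ l ^ 2 / 2 * v := by gcongr
    have h4 := Real.add_one_le_exp (-l * (∫ t, g t ∂ν) + l ^ 2 * v / 2)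
    linarith
  have h := measureReal_le_sum_le (n := n) hint hmgf (-l * (n * (∫ t, g t ∂ν) - y))
  refine (measureReal_mono ?_ (measure_ne_top _ _)).trans (h.trans (le_of_eq ?_))
  · intro x hx
    simp only [Set.mem_ofPred_eq] at hx ⊢
    rw [← Finset.mul_sum]
    nlinarith
  · congr 1
    rw [hl]
    field_simp
    ring

/-- One tilted second moment at the extreme parameter `L` controls every smaller `l` at once. Only
an upper bound `m` on the mean is required, so that truncated variables can be compared with the
mean of the original ones. -/
theorem integral_exp_mul_le {g : α → ℝ} (hg0 : ∀ t, 0 ≤ g t) (hg : Integrable g ν)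
    {l L V m : ℝ} (hl : 0 ≤ l) (hlL : l ≤ L)
    (hL : Integrable (fun t => g t ^ 2 * Real.exp (L * g t)) ν)
    (hV : ∫ t, g t ^ 2 * Real.exp (L * g t) ∂ν ≤ V) (hm : ∫ t, g t ∂ν ≤ m) :
    Integrable (fun t => Real.exp (l * g t)) ν ∧
      ∫ t, Real.exp (l * g t) ∂ν ≤ Real.exp (l * m + l ^ 2 * V) := by
  have hpt (t : α) : Real.exp (l * g t) ≤ 1 + l * g t + l ^ 2 * (g t ^ 2 * Real.exp (L * g t)) := by
    refine (exp_le_one_add_add_sq_mul_exp (mul_nonneg hl (hg0 t))).trans ?_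
    rw [mul_pow, mul_assoc]
    have := hg0 t
    gcongr
  have hi : Integrable (fun t => 1 + l * g t + l ^ 2 * (g t ^ 2 * Real.exp (L * g t))) ν :=
    ((integrable_const _).add (hg.const_mul _)).add (hL.const_mul _)
  have hint : Integrable (fun t => Real.exp (l * g t)) ν := by
    refine Integrable.mono' hi ?_ (Filter.Eventually.of_forall fun t => ?_)
    · exact (Real.continuous_exp.comp_aestronglyMeasurable (hg.aestronglyMeasurable.const_mul _))
    · rw [Real.norm_eq_abs, Real.abs_exp]
      exact hpt t
  refine ⟨hint, (integral_mono hint hi hpt).trans ?_⟩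
  rw [integral_add (by fun_prop) (by fun_prop), integral_add (by fun_prop) (by fun_prop), integral_const_mul, integral_const_mul]
  have h3 : l ^ 2 * ∫ t, g t ^ 2 * Real.exp (L * g t) ∂ν ≤ l ^ 2 * V := by gcongr
  have h5 : l * ∫ t, g t ∂ν ≤ l * m := by gcongr
  have h4 := Real.add_one_le_exp (l * m + l ^ 2 * V)
  simp only [integral_const, probReal_univ, smul_eq_mul, mul_one]
  linarith

/-- The second moment of the normalised sum around `1`. -/
theorem integral_sq_sum_div_sub_one_le {g : α → ℝ} (hg : Integrable g ν)
    (hg2 : Integrable (fun t => g t ^ 2) ν) (hm : 0 < ∫ t, g t ∂ν) (hn : 1 ≤ n) {R : ℝ}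
    (hR : ∫ t, g t ^ 2 ∂ν ≤ R * (∫ t, g t ∂ν) ^ 2) :
    Integrable (fun x : Fin n → α => ((∑ i, g (x i)) / (n * ∫ t, g t ∂ν) - 1) ^ 2)
        (Measure.pi fun _ => ν) ∧
      ∫ x : Fin n → α, ((∑ i, g (x i)) / (n * ∫ t, g t ∂ν) - 1) ^ 2 ∂(Measure.pi fun _ => ν)
        ≤ R / n := by
  have hn' : (0 : ℝ) < n := by exact_mod_cast hn
  have hL : MemLp g 2 ν := (memLp_two_iff_integrable_sq hg.aestronglyMeasurable).2 hg2
  have hS : MemLp (∑ i, fun x : Fin n → α => g (x i)) 2 (Measure.pi fun _ => ν) :=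
    memLp_finsetSum' _ fun i _ => hL.comp_measurePreserving
      (measurePreserving_eval (fun _ : Fin n => ν) i)
  have hS' : MemLp (fun x : Fin n → α => ∑ i, g (x i)) 2 (Measure.pi fun _ => ν) := by
    convert hS using 1
    ext x
    simp
  set m := ∫ t, g t ∂ν
  have hvar : ∫ x : Fin n → α, ((∑ i, g (x i)) - n * m) ^ 2 ∂(Measure.pi fun _ => ν)
      = n * Var[g; ν] := by
    have h := variance_sum_pi (μ := fun _ : Fin n => ν) (X := fun _ => g) (fun _ => hL)
    rw [variance_eq_integral hS.aemeasurable] at h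
    simp only [Finset.sum_apply] at h
    rw [integral_sum_comp_eval hg] at h
    simpa using h
  have heq (x : Fin n → α) : ((∑ i, g (x i)) / (n * m) - 1) ^ 2
      = ((∑ i, g (x i)) - n * m) ^ 2 / (n * m) ^ 2 := by
    field_simp
  simp_rw [heq]
  refine ⟨((hS'.sub (memLp_const _)).integrable_sq).div_const _, ?_⟩
  rw [integral_div, hvar]
  have h1 : Var[g; ν] ≤ R * m ^ 2 :=
    (variance_le_expectation_sq hg.aestronglyMeasurable).trans hR
  rw [div_le_div_iff₀ (by positivity) hn']
  nlinarith [mul_le_mul_of_nonneg_left h1 (sq_nonneg (n : ℝ))]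

end IidSums

/-! ### Absolute moments of the standard normal law. -/

/-- The one-dimensional standard normal distribution. -/
noncomputable abbrev stdNormal : Measure ℝ := gaussianReal 0 1

/-- The absolute moment of order `q` of a standard normal variable. -/
noncomputable def absMoment (q : ℝ) : ℝ := ∫ x, |x| ^ q ∂stdNormal

theorem gaussianPDFReal_std (x : ℝ) :
    gaussianPDFReal 0 1 x = (√(2 * Real.pi))⁻¹ * Real.exp (-x ^ 2 / 2) := by
  simp [gaussianPDFReal_def]

theorem integral_stdNormal (f : ℝ → ℝ) :
    ∫ x, f x ∂stdNormal = ∫ x, gaussianPDFReal 0 1 x * f x := by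
  rw [stdNormal, integral_gaussianReal_eq_integral_smul one_ne_zero]
  simp

theorem gaussianPDFReal_mul_absPow (q s x : ℝ) :
    gaussianPDFReal 0 1 x * (|x| ^ q * Real.exp (s * x ^ 2))
      = (√(2 * Real.pi))⁻¹ * (|x| ^ q * Real.exp (-(1 / 2 - s) * |x| ^ (2 : ℝ))) := by
  rw [gaussianPDFReal_std, Real.rpow_two, sq_abs, mul_assoc, mul_left_comm (Real.exp _),
    ← Real.exp_add]
  ring_nf

theorem integral_absPow_mul_exp {q s : ℝ} (hq : 0 ≤ q) (hs : s < 1 / 2) :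
    ∫ x, |x| ^ q * Real.exp (s * x ^ 2) ∂stdNormal
      = (√Real.pi)⁻¹ * (2 ^ (q / 2) * (1 - 2 * s) ^ (-((q + 1) / 2))
        * Real.Gamma ((q + 1) / 2)) := by
  rw [integral_stdNormal]
  simp_rw [gaussianPDFReal_mul_absPow]
  rw [integral_const_mul, integral_comp_abs
    (f := fun x => x ^ q * Real.exp (-(1 / 2 - s) * x ^ (2 : ℝ))),
    integral_rpow_mul_exp_neg_mul_rpow two_pos (by linarith) (by linarith)]
  have h1 : (1 / 2 - s : ℝ) = (1 - 2 * s) * 2⁻¹ := by ring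
  rw [h1, Real.mul_rpow (by linarith) (by norm_num), Real.inv_rpow (by norm_num),
    Real.sqrt_mul (by norm_num), neg_div, Real.rpow_neg (x := 2) (by norm_num), inv_inv,
    add_div q 1 2, Real.rpow_add (x := 2) (by norm_num), ← Real.sqrt_eq_rpow]
  have : √2 ≠ 0 := by positivity
  field_simp

theorem integrable_absPow_mul_exp {q s : ℝ} (hq : 0 ≤ q) (hs : s < 1 / 2) :
    Integrable (fun x => |x| ^ q * Real.exp (s * x ^ 2)) stdNormal := by
  -- The Bochner integral of a non-integrable function is `0` by convention, so the positive closed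
  -- form already proves integrability.
  refine Integrable.of_integral_ne_zero ?_
  rw [integral_absPow_mul_exp hq hs]
  have h1 := Real.Gamma_pos_of_pos (show 0 < (q + 1) / 2 by linarith)
  have h2 : 0 < 1 - 2 * s := by linarith
  positivity

theorem integrable_absPow {q : ℝ} (hq : 0 ≤ q) : Integrable (fun x => |x| ^ q) stdNormal := by
  simpa using integrable_absPow_mul_exp hq (s := 0) (by norm_num)

theorem absMoment_eq {q : ℝ} (hq : 0 ≤ q) :
    absMoment q = (√Real.pi)⁻¹ * (2 ^ (q / 2) * Real.Gamma ((q + 1) / 2)) := by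
  simpa [absMoment] using integral_absPow_mul_exp hq (s := 0) (by norm_num)

theorem absMoment_pos {q : ℝ} (hq : 0 ≤ q) : 0 < absMoment q := by
  rw [absMoment_eq hq]
  have := Real.Gamma_pos_of_pos (show 0 < (q + 1) / 2 by linarith)
  positivity

theorem integral_absPow_mul_exp_quarter {q : ℝ} (hq : 0 ≤ q) :
    ∫ x, |x| ^ q * Real.exp (1 / 4 * x ^ 2) ∂stdNormal = 2 ^ ((q + 1) / 2) * absMoment q := by
  rw [integral_absPow_mul_exp hq (by norm_num), absMoment_eq hq, Real.rpow_neg (by norm_num),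
    ← Real.inv_rpow (by norm_num)]
  norm_num
  ring

/-- Log-convexity of Gamma at the midpoint of `x` and `x + 1`. -/
theorem Gamma_add_half_sq_le {x : ℝ} (hx : 0 < x) :
    Real.Gamma (x + 1 / 2) ^ 2 ≤ x * Real.Gamma x ^ 2 := by
  have h := Real.Gamma_mul_add_mul_le_rpow_Gamma_mul_rpow_Gamma hx (show 0 < x + 1 by linarith)
    (a := 1 / 2) (b := 1 / 2) (by norm_num) (by norm_num) (by norm_num)
  have hG := Real.Gamma_pos_of_pos hx
  rw [show 1 / 2 * x + 1 / 2 * (x + 1) = x + 1 / 2 by ring, Real.Gamma_add_one hx.ne',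
    ← Real.mul_rpow hG.le (by positivity), ← Real.sqrt_eq_rpow] at h
  calc Real.Gamma (x + 1 / 2) ^ 2 ≤ √(Real.Gamma x * (x * Real.Gamma x)) ^ 2 := by
        have := Real.Gamma_pos_of_pos (show 0 < x + 1 / 2 by linarith)
        gcongr
    _ = x * Real.Gamma x ^ 2 := by rw [Real.sq_sqrt (by positivity)]; ring

/-- The claim amounts to `√π Γ(p + 1/2) ≤ 2^p Γ((p+1)/2)²`. Legendre duplication evaluates `2^p
Γ((p+1)/2) Γ(p/2 + 1)`, and two uses of `Gamma_add_half_sq_le` shift arguments by one half; the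
factors `√p` they produce cancel. -/
theorem absMoment_two_mul_le {p : ℝ} (hp : 1 ≤ p) :
    absMoment (2 * p) ≤ 2 ^ p * absMoment p ^ 2 := by
  have hp0 : 0 < p := by linarith
  set G := Real.Gamma ((p + 1) / 2)
  set G' := Real.Gamma ((p + 1) / 2 + 1 / 2)
  set H := Real.Gamma (p + 1 / 2)
  have hG : 0 < G := Real.Gamma_pos_of_pos (by linarith)
  have hG' : 0 < G' := Real.Gamma_pos_of_pos (by linarith)
  have hH : 0 < H := Real.Gamma_pos_of_pos (by linarith)
  have hP : 0 < Real.Gamma p := Real.Gamma_pos_of_pos hp0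
  have h2p : (0 : ℝ) < 2 ^ p := by positivity
  have h1 : G' ^ 2 ≤ (p + 1) / 2 * G ^ 2 := Gamma_add_half_sq_le (by linarith)
  have h2 : H ^ 2 ≤ p * Real.Gamma p ^ 2 := Gamma_add_half_sq_le hp0
  have h3 : 2 ^ p * (G * G') = p * Real.Gamma p * √Real.pi := by
    have h := Real.Gamma_mul_Gamma_add_half ((p + 1) / 2)
    rw [show 2 * ((p + 1) / 2) = p + 1 by ring, Real.Gamma_add_one hp0.ne',
      show 1 - (p + 1) = -p by ring, Real.rpow_neg (by norm_num)] at h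
    rw [h]
    field_simp
  have hkey : √Real.pi * H ≤ 2 ^ p * G ^ 2 := by
    have hpi := Real.sq_sqrt Real.pi_pos.le
    refine (sq_le_sq₀ (by positivity) (by positivity)).1 ?_
    have h4 : p * (√Real.pi * H) ^ 2 ≤ (2 ^ p * (G * G')) ^ 2 := by
      rw [h3, mul_pow, mul_pow, mul_pow]
      nlinarith [mul_le_mul_of_nonneg_left h2 (show 0 ≤ p * √Real.pi ^ 2 by positivity)]
    have h5 : (2 ^ p * (G * G')) ^ 2 ≤ p * (2 ^ p * G ^ 2) ^ 2 := by
      have h6 : (2 ^ p * G) ^ 2 * G' ^ 2 ≤ (2 ^ p * G) ^ 2 * (p * G ^ 2) :=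
        mul_le_mul_of_nonneg_left (h1.trans (by gcongr; linarith)) (by positivity)
      linarith
    exact le_of_mul_le_mul_left (h4.trans h5) hp0
  rw [absMoment_eq (by linarith), absMoment_eq hp0.le,
    show (2 * p + 1) / 2 = p + 1 / 2 by ring, show 2 * p / 2 = p by ring]
  have hq : ((2 : ℝ) ^ (p / 2)) ^ 2 = 2 ^ p := by
    rw [← Real.rpow_natCast, ← Real.rpow_mul (by norm_num)]; norm_num
  have hpi : 0 < √Real.pi := by positivity
  calc (√Real.pi)⁻¹ * (2 ^ p * H) = (√Real.pi)⁻¹ ^ 2 * (2 ^ p * (√Real.pi * H)) := by field_simp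
    _ ≤ (√Real.pi)⁻¹ ^ 2 * (2 ^ p * (2 ^ p * G ^ 2)) := by gcongr
    _ = 2 ^ p * ((√Real.pi)⁻¹ * (2 ^ (p / 2) * G)) ^ 2 := by
      rw [mul_pow, mul_pow, hq]; ring

/-- Keep only the part `x > a` of the Gamma integral, where `x ^ (a - 1) ≥ a ^ (a - 1)`. -/
theorem rpow_mul_exp_neg_le_Gamma {a : ℝ} (ha : 1 ≤ a) :
    a ^ (a - 1) * Real.exp (-a) ≤ Real.Gamma a := by
  have h0 : 0 < a := by linarith
  rw [Real.Gamma_eq_integral h0, ← integral_exp_neg_Ioi, ← integral_const_mul]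
  calc ∫ x in Set.Ioi a, a ^ (a - 1) * Real.exp (-x)
      ≤ ∫ x in Set.Ioi a, Real.exp (-x) * x ^ (a - 1) := by
        refine setIntegral_mono_on ((integrableOn_exp_neg_Ioi a).const_mul _)
          ((Real.GammaIntegral_convergent h0).mono_set (Set.Ioi_subset_Ioi h0.le))
          measurableSet_Ioi fun x hx => ?_
        rw [mul_comm]
        have : a ≤ x := le_of_lt hx
        gcongr
    _ ≤ ∫ x in Set.Ioi 0, Real.exp (-x) * x ^ (a - 1) := by
        refine setIntegral_mono_set (Real.GammaIntegral_convergent h0) ?_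
          (Set.Ioi_subset_Ioi h0.le).eventuallyLE
        filter_upwards [ae_restrict_mem measurableSet_Ioi] with x hx
        have : 0 < x := hx
        simp only [Pi.zero_apply]
        positivity

/-- A crude Stirling bound. It is the source of the factor `p` in the term `p n^{2/p} ε^{2/p}` and
of the constant `exp (-5)` used throughout. -/
theorem absMoment_ge {p : ℝ} (hp : 1 ≤ p) : (Real.exp (-5) * p) ^ (p / 2) ≤ absMoment p := by
  have hp0 : 0 < p := by linarith
  have ha := rpow_mul_exp_neg_le_Gamma (show 1 ≤ (p + 1) / 2 by linarith)
  rw [absMoment_eq hp0.le]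
  have hexp (x : ℝ) : Real.exp x ^ 2 = Real.exp (2 * x) := by
    rw [← Real.exp_nat_mul]; norm_num
  have hr {x : ℝ} (hx : 0 ≤ x) : (x ^ (p / 2)) ^ 2 = x ^ p := by
    rw [← Real.rpow_natCast, ← Real.rpow_mul hx]; norm_num
  refine le_trans ?_ (mul_le_mul_of_nonneg_left (mul_le_mul_of_nonneg_left ha
    (show (0 : ℝ) ≤ 2 ^ (p / 2) by positivity)) (by positivity))
  refine (sq_le_sq₀ (by positivity) (by positivity)).1 ?_
  rw [hr (by positivity), mul_pow, mul_pow, mul_pow, hr (by norm_num), hexp, inv_pow,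
    Real.sq_sqrt Real.pi_pos.le, ← Real.rpow_natCast, ← Real.rpow_mul (by positivity),
    Real.mul_rpow (by positivity) hp0.le, ← Real.exp_mul]
  have e1 : ((p + 1) / 2 - 1) * ((2 : ℕ) : ℝ) = p - 1 := by push_cast; ring
  rw [e1, Real.rpow_sub_one (by positivity), Real.div_rpow (by positivity) (by norm_num),
    show 2 * -((p + 1) / 2) = -(p + 1) by ring]
  have h2 : (0 : ℝ) < 2 ^ p := by positivity
  have e2 : Real.pi⁻¹ * (2 ^ p * ((p + 1) ^ p / 2 ^ p / ((p + 1) / 2) * Real.exp (-(p + 1))))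
      = (p + 1) ^ p * ((Real.pi * ((p + 1) / 2))⁻¹ * Real.exp (-(p + 1))) := by
    field_simp
  rw [e2, mul_comm]
  have h3 : p ^ p ≤ (p + 1) ^ p := by gcongr; linarith
  refine mul_le_mul h3 ?_ (by positivity) (by positivity)
  -- The polynomial prefactor costs `exp (-3p)` and the Gamma bound `exp (-(p + 1))`; together at
  -- least `exp (-5p)` because `p ≥ 1`.
  have h4 : Real.pi * ((p + 1) / 2) ≤ Real.exp (3 * p) := by
    have h5 := Real.add_one_le_exp p
    have h6 := Real.quadratic_le_exp_of_nonneg (show 0 ≤ 2 * p by linarith)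
    have h7 : Real.exp (3 * p) = Real.exp p * Real.exp (2 * p) := by rw [← Real.exp_add]; ring_nf
    rw [h7, mul_comm]
    have := Real.pi_lt_four
    apply mul_le_mul _ _ Real.pi_pos.le (Real.exp_pos _).le
    · linarith
    · nlinarith
  calc Real.exp (-5 * p) ≤ Real.exp (-(3 * p) + -(p + 1)) := Real.exp_le_exp.2 (by linarith)
    _ = (Real.exp (3 * p))⁻¹ * Real.exp (-(p + 1)) := by rw [Real.exp_add, Real.exp_neg]
    _ ≤ _ := by gcongr

/-! ### Tails and quantiles of the standard normal law. -/

theorem setIntegral_Ioi_comp_add (f : ℝ → ℝ) (a h : ℝ) :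
    ∫ x in Set.Ioi a, f (x + h) = ∫ x in Set.Ioi (a + h), f x := by
  have := (measurePreserving_add_right (volume : Measure ℝ) h).setIntegral_preimage_emb
    (measurableEmbedding_addRight h) f (Set.Ioi (a + h))
  simpa using this

/-- The probability that a standard normal variable exceeds `t` in absolute value. -/
noncomputable def gaussTail (t : ℝ) : ℝ := stdNormal.real {x | t < |x|}

theorem integral_indicator_comp_abs {b : ℝ} (hb : 0 ≤ b) (h : ℝ → ℝ) :
    ∫ x, {x | b < |x|}.indicator (fun x => h |x|) x ∂stdNormal
      = 2 * ∫ x in Set.Ioi b, gaussianPDFReal 0 1 x * h x := by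
  rw [integral_stdNormal]
  have h1 (x : ℝ) : gaussianPDFReal 0 1 x * {x | b < |x|}.indicator (fun x => h |x|) x
      = (Set.Ioi b).indicator (fun y => gaussianPDFReal 0 1 y * h y) |x| := by
    by_cases hx : b < |x|
    · rw [Set.indicator_of_mem (by exact hx), Set.indicator_of_mem (by exact hx)]
      simp [gaussianPDFReal_std, sq_abs]
    · rw [Set.indicator_of_notMem (by exact hx), Set.indicator_of_notMem (by exact hx)]
      simp
  simp_rw [h1]
  rw [integral_comp_abs, setIntegral_indicator measurableSet_Ioi, Set.Ioi_inter_Ioi,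
    sup_eq_right.2 hb]

theorem measurableSet_lt_abs (b : ℝ) : MeasurableSet {x : ℝ | b < |x|} :=
  measurableSet_lt measurable_const measurable_norm

theorem gaussTail_eq {t : ℝ} (ht : 0 ≤ t) :
    gaussTail t = 2 * ∫ x in Set.Ioi t, gaussianPDFReal 0 1 x := by
  have h := integral_indicator_comp_abs ht (fun _ => 1)
  rw [integral_indicator (measurableSet_lt_abs t)] at h
  simpa [gaussTail] using h

theorem gaussTail_nonneg (t : ℝ) : 0 ≤ gaussTail t := measureReal_nonneg

theorem gaussTail_zero : gaussTail 0 = 1 := by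
  have h : ({x : ℝ | 0 < |x|} : Set ℝ)ᶜ = {0} := by ext x; simp
  have := nullSingletonClass_gaussianReal (μ := 0) (v := 1) one_ne_zero
  have h2 := probReal_compl_eq_one_sub (μ := stdNormal) (measurableSet_lt_abs 0)
  rw [h] at h2
  simp only [Measure.real, measure_singleton, ENNReal.toReal_zero] at h2
  unfold gaussTail Measure.real
  linarith

/-- Translate by `h`: the density satisfies `φ(x + h) = φ(x) exp (-h x - h²/2)`, and `x > t - h`. -/
theorem exp_mul_gaussTail_le {t h : ℝ} (hh : 0 ≤ h) (hht : h ≤ t) :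
    Real.exp (h * t - h ^ 2 / 2) * gaussTail t ≤ gaussTail (t - h) := by
  rw [gaussTail_eq (by linarith), gaussTail_eq (by linarith),
    ← sub_add_cancel t h, ← setIntegral_Ioi_comp_add, add_sub_cancel_right, mul_left_comm,
    ← integral_const_mul]
  refine mul_le_mul_of_nonneg_left ?_ two_pos.le
  refine setIntegral_mono_on ?_ (integrable_gaussianPDFReal 0 1).integrableOn measurableSet_Ioi
    fun x hx => ?_
  · exact (((integrable_gaussianPDFReal 0 1).comp_add_right h).const_mul _).integrableOn
  · have hx' : t - h < x := hx
    rw [gaussianPDFReal_std, gaussianPDFReal_std, mul_left_comm, ← Real.exp_add]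
    gcongr
    nlinarith

theorem exp_mul_gaussTail_le_scale {b d : ℝ} (hb : 0 ≤ b) (hd : 0 ≤ d) (hd1 : d ≤ 1) :
    Real.exp (b ^ 2 * d / 2) * gaussTail b ≤ gaussTail ((1 - d) * b) := by
  have h := exp_mul_gaussTail_le (t := b) (h := d * b) (by positivity) (by nlinarith)
  rw [show (1 - d) * b = b - d * b by ring]
  refine le_trans (mul_le_mul_of_nonneg_right (Real.exp_le_exp.2 ?_) (gaussTail_nonneg b)) h
  nlinarith [mul_nonneg (sq_nonneg b) (mul_nonneg hd (sub_nonneg.2 hd1))]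

/-- Integrate over `(b, b + 1]` only and use `(b + 1)² ≤ 2b² + 2`. Applied at the `1/n` quantile, it
gives `b² ≥ log n - 2`. -/
theorem gaussTail_ge {b : ℝ} (hb : 0 ≤ b) : Real.exp (-b ^ 2 - 2) ≤ gaussTail b := by
  rw [gaussTail_eq hb]
  have hpi : √(2 * Real.pi) ≤ 4 := by
    rw [Real.sqrt_le_left (by norm_num)]
    nlinarith [Real.pi_lt_four]
  have hpos : 0 < √(2 * Real.pi) := by positivity
  have h1 : ∫ x in Set.Ioc b (b + 1), (√(2 * Real.pi))⁻¹ * Real.exp (-(b + 1) ^ 2 / 2)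
      ≤ ∫ x in Set.Ioi b, gaussianPDFReal 0 1 x := by
    refine le_trans (setIntegral_mono_on (integrableOn_const (by simp)) (integrable_gaussianPDFReal 0 1).integrableOn
      measurableSet_Ioc fun x hx => ?_) (setIntegral_mono_set
        (integrable_gaussianPDFReal 0 1).integrableOn
        (Filter.Eventually.of_forall fun x => gaussianPDFReal_nonneg 0 1 x)
        (Set.Ioc_subset_Ioi_self.eventuallyLE))
    rw [gaussianPDFReal_std]
    have := hx.1
    have := hx.2
    gcongr
    linarith
  have h2 : Real.exp (-b ^ 2 - 2) ≤ 2 * (4⁻¹ * Real.exp (-(b + 1) ^ 2 / 2)) := by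
    have h3 : (2 : ℝ) ≤ Real.exp 1 := by linarith [Real.add_one_le_exp 1]
    have h4 : Real.exp (-b ^ 2 - 2) * 2 ≤ Real.exp (-b ^ 2 - 2) * Real.exp 1 := by gcongr
    rw [← Real.exp_add] at h4
    have h5 : Real.exp (-b ^ 2 - 2 + 1) ≤ Real.exp (-(b + 1) ^ 2 / 2) :=
      Real.exp_le_exp.2 (by nlinarith [sq_nonneg (b - 1)])
    linarith
  have h3 : 4⁻¹ * Real.exp (-(b + 1) ^ 2 / 2)
      ≤ (√(2 * Real.pi))⁻¹ * Real.exp (-(b + 1) ^ 2 / 2) := by gcongr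
  rw [setIntegral_const] at h1
  simp only [Measure.real, Real.volume_Ioc, add_sub_cancel_left, ENNReal.ofReal_one,
    ENNReal.toReal_one, one_smul] at h1
  linarith

theorem exists_gaussTail_eq {y : ℝ} (hy : 0 < y) (hy1 : y ≤ 1) : ∃ b, 0 ≤ b ∧ gaussTail b = y := by
  have hint := integrable_gaussianPDFReal 0 1
  have h1 : ∀ t, 0 ≤ t → gaussTail t = 1 - 2 * ∫ x in (0 : ℝ)..t, gaussianPDFReal 0 1 x := by
    intro t ht
    have h := intervalIntegral.integral_Ioi_sub_Ioi (a := 0) (b := t)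
      (f := gaussianPDFReal 0 1) (μ := volume) hint.integrableOn ht
    have h0 := gaussTail_eq le_rfl
    rw [gaussTail_zero] at h0
    rw [gaussTail_eq ht, ← h]
    linarith
  have hcont : Continuous fun t => 1 - 2 * ∫ x in (0 : ℝ)..t, gaussianPDFReal 0 1 x :=
    continuous_const.sub (continuous_const.mul
      (intervalIntegral.continuous_primitive (fun _ _ => hint.intervalIntegrable) 0))
  have hlim : Filter.Tendsto (fun t => 1 - 2 * ∫ x in (0 : ℝ)..t, gaussianPDFReal 0 1 x)
      Filter.atTop (nhds 0) := by
    have h := intervalIntegral_tendsto_integral_Ioi 0 hint.integrableOn Filter.tendsto_id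
    have h0 := gaussTail_eq le_rfl
    rw [gaussTail_zero] at h0
    have h2 := (h.const_mul 2).const_sub 1
    rwa [← h0, sub_self] at h2
  obtain ⟨T, hT, hT0⟩ := ((hlim.eventually (gt_mem_nhds hy)).and
    (Filter.eventually_ge_atTop 0)).exists
  obtain ⟨b, hb, hby⟩ := intermediate_value_Icc' hT0 hcont.continuousOn
    (show y ∈ Set.Icc _ _ from ⟨hT.le, by simpa using hy1⟩)
  exact ⟨b, hb.1, by rw [h1 b hb.1]; exact hby⟩

/-- Beyond `b`, `(x/b)^q ≤ exp (q (x/b - 1)) ≤ exp (b (x - b) / 2)`, and this growth rate is only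
half the decay rate `b` of the density at `b`. -/
theorem integral_indicator_div_rpow_le {b q : ℝ} (hb : 0 < b) (hq0 : 0 ≤ q) (hq : q ≤ b ^ 2 / 2) :
    Integrable ({x | b < |x|}.indicator fun x => (|x| / b) ^ q) stdNormal ∧
      ∫ x, {x | b < |x|}.indicator (fun x => (|x| / b) ^ q) x ∂stdNormal ≤ 2 * gaussTail b := by
  have hint : Integrable (fun x => (|x| / b) ^ q) stdNormal := by
    simp_rw [Real.div_rpow (abs_nonneg _) hb.le]
    exact (integrable_absPow hq0).div_const _
  refine ⟨hint.indicator (measurableSet_lt_abs b), ?_⟩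
  have hφ := integrable_gaussianPDFReal 0 1
  rw [integral_indicator_comp_abs hb.le (fun x => (x / b) ^ q), gaussTail_eq hb.le]
  gcongr
  set F : ℝ → ℝ := fun x => gaussianPDFReal 0 1 x * Real.exp (b * (x - b) / 2)
  have hF : Integrable F := by
    have h := (hφ.comp_sub_right (b / 2)).mul_const (Real.exp (-3 * b ^ 2 / 8))
    refine h.congr (Filter.Eventually.of_forall fun x => ?_)
    simp only [F, gaussianPDFReal_std, mul_assoc, ← Real.exp_add]
    ring_nf
  have h1 : ∫ x in Set.Ioi b, gaussianPDFReal 0 1 x * (x / b) ^ q ≤ ∫ x in Set.Ioi b, F x := by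
    refine integral_mono_of_nonneg ?_ hF.integrableOn ?_
    · filter_upwards [ae_restrict_mem measurableSet_Ioi] with x hx
      have : 0 < x := hb.trans hx
      have := gaussianPDFReal_nonneg 0 1 x
      simp only [Pi.zero_apply]
      positivity
    · filter_upwards [ae_restrict_mem measurableSet_Ioi] with x hx
      have hx' : b < x := hx
      have h0 : 0 < x := hb.trans hx
      refine mul_le_mul_of_nonneg_left ?_ (gaussianPDFReal_nonneg 0 1 x)
      rw [Real.rpow_def_of_pos (by positivity)]
      refine Real.exp_le_exp.2 ?_
      have h2 := Real.log_le_sub_one_of_pos (show 0 < x / b by positivity)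
      have h3 : 0 ≤ x / b - 1 := by rw [sub_nonneg, one_le_div hb]; exact hx'.le
      calc Real.log (x / b) * q ≤ (x / b - 1) * (b ^ 2 / 2) := by gcongr
        _ = b * (x - b) / 2 := by field_simp
  -- Stretching by `2` about `b` produces the factor `2` and leaves an integrand bounded pointwise
  -- by the density.
  have h2 : ∫ x in Set.Ioi b, F x = 2 * ∫ x in Set.Ioi b, F (2 * x - b) := by
    have e1 := integral_comp_mul_left_Ioi' (fun y => F (y - b)) b (two_pos)
    have e2 := setIntegral_Ioi_comp_add F (2 * b) (-b)
    rw [smul_eq_mul] at e1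
    rw [e1]
    simp only [← sub_eq_add_neg] at e2
    rw [e2]
    ring_nf
  refine h1.trans ?_
  rw [h2, mul_le_mul_iff_right₀ two_pos]
  refine setIntegral_mono_on ?_ hφ.integrableOn measurableSet_Ioi fun x hx => ?_
  · exact ((hF.comp_sub_right b).comp_mul_left' two_ne_zero).integrableOn
  · have hx' : b < x := hx
    simp only [F, gaussianPDFReal_std, mul_assoc, ← Real.exp_add]
    gcongr
    nlinarith [sq_nonneg (x - b)]

/-! ### Lower tail of the power sum and the mean of the norm. -/

/-- The standard normal distribution on `Fin n → ℝ`. -/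
noncomputable abbrev gaussPi (n : ℕ) : Measure (Fin n → ℝ) := Measure.pi fun _ => stdNormal

section PowerSums

variable {n : ℕ} {p ε : ℝ}

theorem sq_absPow (x : ℝ) : (|x| ^ p) ^ 2 = |x| ^ (2 * p) := by
  rw [← Real.rpow_natCast, ← Real.rpow_mul (abs_nonneg x)]
  norm_num [mul_comm]

theorem integrable_absPow_sq (hp : 1 ≤ p) : Integrable (fun x => (|x| ^ p) ^ 2) stdNormal := by
  simp_rw [sq_absPow]
  exact integrable_absPow (by linarith)

theorem integral_absPow_sq_le (hp : 1 ≤ p) :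
    ∫ x, (|x| ^ p) ^ 2 ∂stdNormal ≤ 2 ^ p * absMoment p ^ 2 := by
  simp_rw [sq_absPow]
  exact absMoment_two_mul_le hp

theorem measureReal_sum_absPow_le (hp : 1 ≤ p) (hn : 1 ≤ n) (hε : 0 ≤ ε) :
    (gaussPi n).real {x | ∑ i, |x i| ^ p ≤ (1 - ε) * (n * absMoment p)}
      ≤ Real.exp (-(n * ε ^ 2 / (2 * 2 ^ p))) := by
  have hm := absMoment_pos (show 0 ≤ p by linarith)
  have hn' : (0 : ℝ) < n := by exact_mod_cast hn
  have h := measureReal_sum_le_sub (ν := stdNormal) (n := n) (g := fun x => |x| ^ p)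
    (fun x => by positivity) (integrable_absPow (by linarith)) (integrable_absPow_sq hp)
    (integral_absPow_sq_le hp) (by positivity) hn (y := ε * (n * absMoment p)) (by positivity)
  convert h using 2
  · ext x
    simp only [Set.mem_ofPred_eq]
    rw [show ∫ t, |t| ^ p ∂stdNormal = absMoment p from rfl]
    ring_nf
  · field_simp

theorem sum_absPow_rpow_eq (hp : 1 ≤ p) (hn : 1 ≤ n) (x : Fin n → ℝ) :
    (∑ i, |x i| ^ p) ^ (1 / p)
      = (n * absMoment p) ^ (1 / p) * ((∑ i, |x i| ^ p) / (n * absMoment p)) ^ (1 / p) := by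
  have hm := absMoment_pos (show 0 ≤ p by linarith)
  have hn' : (0 : ℝ) < n := by exact_mod_cast hn
  rw [← Real.mul_rpow (by positivity) (by positivity), mul_div_cancel₀ _ (by positivity)]

theorem rpow_one_div_le {y : ℝ} (hp : 1 ≤ p) (hy : 0 ≤ y) : y ^ (1 / p) ≤ 1 + (y - 1) / p := by
  have h := rpow_one_add_le_one_add_mul_self (s := y - 1) (by linarith) (p := 1 / p)
    (by positivity) ((div_le_one (by linarith)).2 hp)
  rw [add_sub_cancel] at h
  linarith [show 1 / p * (y - 1) = (y - 1) / p by ring]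

theorem integrable_sum_absPow_div (hp : 1 ≤ p) :
    Integrable (fun x : Fin n → ℝ => (∑ i, |x i| ^ p) / (n * absMoment p)) (gaussPi n) :=
  (integrable_sum_comp_eval (integrable_absPow (by linarith))).div_const _

theorem integral_sum_absPow_div (hp : 1 ≤ p) (hn : 1 ≤ n) :
    ∫ x : Fin n → ℝ, (∑ i, |x i| ^ p) / (n * absMoment p) ∂gaussPi n = 1 := by
  have hm := absMoment_pos (show 0 ≤ p by linarith)
  have hn' : (0 : ℝ) < n := by exact_mod_cast hn
  rw [integral_div, integral_sum_comp_eval (g := fun x => |x| ^ p) (integrable_absPow (by linarith))]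
  exact div_self (by change (n : ℝ) * absMoment p ≠ 0; positivity)

theorem measurable_sum_absPow_rpow (n : ℕ) (p : ℝ) :
    Measurable fun x : Fin n → ℝ => (∑ i, |x i| ^ p) ^ (1 / p) := by
  have (i : Fin n) : Measurable fun x : Fin n → ℝ => |x i| := (measurable_pi_apply i).norm
  fun_prop

theorem integrable_sum_absPow_rpow (hp : 1 ≤ p) :
    Integrable (fun x : Fin n → ℝ => (∑ i, |x i| ^ p) ^ (1 / p)) (gaussPi n) := by
  have hi : Integrable (fun x : Fin n → ℝ => 1 + ((∑ i, |x i| ^ p) - 1) / p) (gaussPi n) :=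
    (integrable_const _).add (((integrable_sum_comp_eval (integrable_absPow (by linarith))).sub
      (integrable_const _)).div_const _)
  refine hi.mono' (measurable_sum_absPow_rpow n p).aestronglyMeasurable
    (Filter.Eventually.of_forall fun x => ?_)
  rw [Real.norm_of_nonneg (by positivity)]
  exact rpow_one_div_le hp (by positivity)

theorem integral_sum_absPow_rpow_le (hp : 1 ≤ p) (hn : 1 ≤ n) :
    ∫ x : Fin n → ℝ, (∑ i, |x i| ^ p) ^ (1 / p) ∂gaussPi n ≤ (n * absMoment p) ^ (1 / p) := by
  have hm := absMoment_pos (show 0 ≤ p by linarith)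
  simp_rw [sum_absPow_rpow_eq hp hn, integral_const_mul]
  refine mul_le_of_le_one_right (by positivity) ?_
  have hi := integrable_sum_absPow_div (n := n) hp
  calc ∫ x : Fin n → ℝ, ((∑ i, |x i| ^ p) / (n * absMoment p)) ^ (1 / p) ∂gaussPi n
      ≤ ∫ x : Fin n → ℝ, (1 + ((∑ i, |x i| ^ p) / (n * absMoment p) - 1) / p) ∂gaussPi n := by
        refine integral_mono_of_nonneg (Filter.Eventually.of_forall fun x => ?_)
          ((integrable_const _).add ((hi.sub (integrable_const _)).div_const _))
          (Filter.Eventually.of_forall fun x => ?_)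
        · simp only [Pi.zero_apply]
          positivity
        · exact rpow_one_div_le hp (by positivity)
    _ = 1 := by
        rw [integral_add (by fun_prop) (by fun_prop), integral_div, integral_sub hi (by fun_prop),
          integral_sum_absPow_div hp hn]
        simp

/-- With `y` the normalised power sum, `y^{1/p} ≥ min y 1`, which lies above the parabola `1 - ε/8 -
(2/ε)(y - 1)²`. Since `E(y - 1)² ≤ 2^p / n`, the hypothesis makes the quadratic loss at most another
`ε/8`. -/
theorem le_integral_sum_absPow_rpow (hp : 1 ≤ p) (hn : 1 ≤ n) (hε : 0 < ε)
    (h : 16 * 2 ^ p ≤ n * ε ^ 2) :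
    (1 - ε / 4) * (n * absMoment p) ^ (1 / p)
      ≤ ∫ x : Fin n → ℝ, (∑ i, |x i| ^ p) ^ (1 / p) ∂gaussPi n := by
  have hm := absMoment_pos (show 0 ≤ p by linarith)
  have hn' : (0 : ℝ) < n := by exact_mod_cast hn
  simp_rw [sum_absPow_rpow_eq hp hn, integral_const_mul]
  rw [mul_comm]
  gcongr
  obtain ⟨hvi, hv⟩ := integral_sq_sum_div_sub_one_le (ν := stdNormal) (n := n)
    (g := fun x => |x| ^ p) (integrable_absPow (by linarith)) (integrable_absPow_sq hp)
    hm hn (integral_absPow_sq_le hp)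
  change Integrable (fun x : Fin n → ℝ => ((∑ i, |x i| ^ p) / (n * absMoment p) - 1) ^ 2)
    (gaussPi n) at hvi
  change ∫ x : Fin n → ℝ, ((∑ i, |x i| ^ p) / (n * absMoment p) - 1) ^ 2 ∂gaussPi n ≤ _ at hv
  have hpt (y : ℝ) (hy : 0 ≤ y) : 1 - ε / 8 - (y - 1) ^ 2 * (2 / ε) ≤ y ^ (1 / p) := by
    have h1 : min y 1 ≤ y ^ (1 / p) := by
      rcases le_total y 1 with hy1 | hy1
      · rw [min_eq_left hy1]
        rcases hy.eq_or_lt with rfl | hy0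
        · positivity
        · exact Real.self_le_rpow_of_le_one hy hy1 ((div_le_one (by linarith)).2 hp)
      · rw [min_eq_right hy1]
        exact Real.one_le_rpow hy1 (by positivity)
    refine le_trans (le_min ?_ ?_) h1
    · have h2 : (y - 1) ^ 2 * (2 / ε) + ε / 8 - (1 - y)
          = 2 / ε * ((y - 1) + ε / 4) ^ 2 := by field_simp; ring
      nlinarith [show 0 ≤ 2 / ε * ((y - 1) + ε / 4) ^ 2 by positivity]
    · have : 0 ≤ (y - 1) ^ 2 * (2 / ε) := by positivity
      linarith
  have hi : Integrable (fun x : Fin n → ℝ =>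
      ((∑ i, |x i| ^ p) / (n * absMoment p)) ^ (1 / p)) (gaussPi n) := by
    have h1 := (integrable_sum_absPow_rpow (n := n) hp).div_const ((n * absMoment p) ^ (1 / p))
    refine h1.congr (Filter.Eventually.of_forall fun x => ?_)
    exact (Real.div_rpow (by positivity) (by positivity) _).symm
  calc 1 - ε / 4 ≤ 1 - ε / 8 - 2 ^ p / n * (2 / ε) := by
        have : (2 : ℝ) ^ p / n * (2 / ε) ≤ ε / 8 := by
          rw [div_mul_div_comm, div_le_div_iff₀ (by positivity) (by norm_num)]
          nlinarith
        linarith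
    _ ≤ 1 - ε / 8 - (∫ x : Fin n → ℝ, ((∑ i, |x i| ^ p) / (n * absMoment p) - 1) ^ 2 ∂gaussPi n)
          * (2 / ε) := by gcongr
    _ = ∫ x : Fin n → ℝ, (1 - ε / 8 - ((∑ i, |x i| ^ p) / (n * absMoment p) - 1) ^ 2 * (2 / ε))
          ∂gaussPi n := by
        rw [integral_sub (by fun_prop) (hvi.mul_const _), integral_mul_const]
        simp
    _ ≤ _ := integral_mono ((integrable_const _).sub (hvi.mul_const _)) hi
        fun x => hpt _ (by positivity)

theorem one_sub_le_measureReal_of_compl_subset {α : Type*} [MeasurableSpace α] {μ : Measure α}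
    [IsProbabilityMeasure μ] {s t u : Set α} (hs : MeasurableSet s) (h : sᶜ ⊆ t ∪ u) {a b : ℝ}
    (ht : μ.real t ≤ a) (hu : μ.real u ≤ b) : 1 - (a + b) ≤ μ.real s := by
  have h1 := probReal_compl_eq_one_sub (μ := μ) hs
  have h2 := (measureReal_mono h (measure_ne_top μ _)).trans (measureReal_union_le t u)
  linarith

theorem measurableSet_mem_interval (n : ℕ) (p a b : ℝ) :
    MeasurableSet {x : Fin n → ℝ | a ≤ (∑ i, |x i| ^ p) ^ (1 / p) ∧
      (∑ i, |x i| ^ p) ^ (1 / p) ≤ b} :=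
  (measurableSet_le measurable_const (measurable_sum_absPow_rpow n p)).inter
    (measurableSet_le (measurable_sum_absPow_rpow n p) measurable_const)

/-- Reduces concentration of the norm about its mean to tails of the power sum: `(1 - ε)^p ≤ 1 - ε`
below, and `(1 + ε)(1 - ε/4) ≥ 1 + ε/2` with Bernoulli's inequality above. -/
theorem one_sub_le_measureReal_near_mean (hp : 1 ≤ p) (hn : 1 ≤ n) (hε : 0 < ε) (hε1 : ε < 1)
    (h : 16 * 2 ^ p ≤ n * ε ^ 2) {B : ℝ}
    (hB : (gaussPi n).real {x | (1 + p * ε / 2) * (n * absMoment p) ≤ ∑ i, |x i| ^ p} ≤ B) :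
    1 - (Real.exp (-(n * ε ^ 2 / (2 * 2 ^ p))) + B) ≤ (gaussPi n).real
      {x | (1 - ε) * (∫ y, (∑ i, |y i| ^ p) ^ (1 / p) ∂gaussPi n) ≤ (∑ i, |x i| ^ p) ^ (1 / p) ∧
        (∑ i, |x i| ^ p) ^ (1 / p) ≤ (1 + ε) * ∫ y, (∑ i, |y i| ^ p) ^ (1 / p) ∂gaussPi n} := by
  have hm := absMoment_pos (show 0 ≤ p by linarith)
  have hn' : (0 : ℝ) < n := by exact_mod_cast hn
  have hp0 : 0 < p := by linarith
  refine one_sub_le_measureReal_of_compl_subset (measurableSet_mem_interval n p _ _) ?_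
    (measureReal_sum_absPow_le hp hn hε.le) hB
  have hup := integral_sum_absPow_rpow_le hp hn
  have hlo := le_integral_sum_absPow_rpow hp hn hε h
  set E := ∫ y : Fin n → ℝ, (∑ i, |y i| ^ p) ^ (1 / p) ∂gaussPi n
  set K := (n : ℝ) * absMoment p
  have hK : 0 < K := by positivity
  have hM : 0 < K ^ (1 / p) := by positivity
  have hpow {y : ℝ} (hy : 0 ≤ y) : (y ^ (1 / p)) ^ p = y := by
    rw [← Real.rpow_mul hy, one_div_mul_cancel hp0.ne', Real.rpow_one]
  intro x hx
  simp only [Set.mem_compl_iff, Set.mem_ofPred_eq, not_and_or, not_le] at hx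
  simp only [Set.mem_union, Set.mem_ofPred_eq]
  have hS : 0 ≤ ∑ i, |x i| ^ p := by positivity
  rcases hx with hx | hx
  · left
    have h1 : (∑ i, |x i| ^ p) ^ (1 / p) ≤ (1 - ε) * K ^ (1 / p) :=
      hx.le.trans (mul_le_mul_of_nonneg_left hup (by linarith))
    have h2 := Real.rpow_le_rpow (by positivity) h1 hp0.le
    rw [hpow hS, Real.mul_rpow (by linarith) hM.le, hpow hK.le] at h2
    refine h2.trans (mul_le_mul_of_nonneg_right ?_ hK.le)
    exact Real.rpow_le_self_of_le_one (by linarith) (by linarith) hp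
  · right
    have h1 : (1 + ε / 2) * K ^ (1 / p) ≤ (∑ i, |x i| ^ p) ^ (1 / p) := by
      refine le_trans ?_ hx.le
      refine le_trans ?_ (mul_le_mul_of_nonneg_left hlo (by linarith))
      rw [← mul_assoc]
      gcongr
      nlinarith
    have h2 := Real.rpow_le_rpow (by positivity) h1 hp0.le
    rw [hpow hS, Real.mul_rpow (by linarith) hM.le, hpow hK.le] at h2
    refine le_trans (mul_le_mul_of_nonneg_right ?_ hK.le) h2
    have := one_add_mul_self_le_rpow_one_add (s := ε / 2) (by linarith) hp
    linarith

end PowerSums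

/-! ### Upper tail of the power sum. -/

section UpperTails

variable {n : ℕ} {p ε : ℝ}

theorem exp_neg_five_lt : Real.exp (-5) < 1 / 64 := by
  have h1 : (5 / 2 : ℝ) ≤ Real.exp 1 := by linarith [Real.exp_one_gt_d9]
  have h2 : Real.exp (-5) * Real.exp 1 ^ 5 = 1 := by
    rw [← Real.exp_nat_mul, ← Real.exp_add]; norm_num
  have h3 : (64 : ℝ) < Real.exp 1 ^ 5 :=
    lt_of_lt_of_le (by norm_num) (pow_le_pow_left₀ (by norm_num) h1 5)
  nlinarith [Real.exp_pos (-5)]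

theorem exp_neg_five_le_absMoment (hp : 1 ≤ p) (hp2 : p ≤ 2) : Real.exp (-5) ≤ absMoment p := by
  refine le_trans ?_ (absMoment_ge hp)
  have h1 : Real.exp (-5) ≤ Real.exp (-5) ^ (p / 2) := by
    rw [← Real.exp_mul, Real.exp_le_exp]
    linarith
  exact h1.trans (Real.rpow_le_rpow (Real.exp_pos _).le
    (le_mul_of_one_le_right (Real.exp_pos _).le hp) (by linarith))

theorem integral_absPow_mul_exp_quarter_le (hp : 1 ≤ p) :
    ∫ x, |x| ^ (2 * p) * Real.exp (1 / 4 * x ^ 2) ∂stdNormal ≤ 2 * 4 ^ p * absMoment p ^ 2 := by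
  rw [integral_absPow_mul_exp_quarter (by linarith)]
  have h1 : (2 : ℝ) ^ ((2 * p + 1) / 2) ≤ 2 * 2 ^ p := by
    rw [show (2 : ℝ) * 2 ^ p = 2 ^ (1 + p) by rw [Real.rpow_add two_pos, Real.rpow_one]]
    gcongr
    · norm_num
    · linarith
  have h4 : (4 : ℝ) ^ p = 2 ^ p * 2 ^ p := by
    rw [← Real.mul_rpow (by norm_num) (by norm_num)]; norm_num
  calc _ ≤ 2 * 2 ^ p * (2 ^ p * absMoment p ^ 2) := by
        exact mul_le_mul h1 (absMoment_two_mul_le hp) (absMoment_pos (by linarith)).le (by positivity)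
    _ = _ := by rw [h4]; ring

theorem measureReal_le_sum_absPow_of_le_two (hp : 1 ≤ p) (hp2 : p ≤ 2) (hε : 0 < ε)
    (hε1 : ε < 1) :
    (gaussPi n).real {x | (1 + p * ε / 2) * (n * absMoment p) ≤ ∑ i, |x i| ^ p}
      ≤ Real.exp (-(Real.exp (-5) / 16 * n * ε ^ 2)) := by
  have hm := exp_neg_five_le_absMoment hp hp2
  set m := absMoment p with hmdef
  set η := Real.exp (-5) with hη
  have hη0 : 0 < η := Real.exp_pos _
  have hm0 : 0 < m := by linarith
  have hη1 : η ≤ 1 / 64 := exp_neg_five_lt.le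
  have hg (x : ℝ) : |x| ^ p ≤ 1 + x ^ 2 := by
    rcases le_total |x| 1 with h | h
    · have := Real.rpow_le_one (abs_nonneg x) h (by linarith : 0 ≤ p)
      nlinarith [sq_nonneg x]
    · have := Real.rpow_le_rpow_of_exponent_le h hp2
      rw [Real.rpow_two, sq_abs] at this
      linarith
  have hpt (x : ℝ) : (|x| ^ p) ^ 2 * Real.exp (1 / 4 * |x| ^ p)
      ≤ Real.exp (1 / 4) * (|x| ^ (2 * p) * Real.exp (1 / 4 * x ^ 2)) := by
    rw [sq_absPow, mul_left_comm, ← Real.exp_add]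
    gcongr
    linarith [hg x]
  have hi := (integrable_absPow_mul_exp (q := 2 * p) (s := 1 / 4) (by linarith)
    (by norm_num)).const_mul (Real.exp (1 / 4))
  have hL : Integrable (fun x => (|x| ^ p) ^ 2 * Real.exp (1 / 4 * |x| ^ p)) stdNormal := by
    refine hi.mono' (by fun_prop) (Filter.Eventually.of_forall fun x => ?_)
    rw [Real.norm_of_nonneg (by positivity)]
    exact hpt x
  have hV : ∫ x, (|x| ^ p) ^ 2 * Real.exp (1 / 4 * |x| ^ p) ∂stdNormal ≤ 64 * m ^ 2 := by
    refine (integral_mono hL hi hpt).trans ?_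
    rw [integral_const_mul]
    have h4 : (4 : ℝ) ^ p ≤ 16 := by
      calc (4 : ℝ) ^ p ≤ 4 ^ (2 : ℝ) := by gcongr; norm_num
        _ = 16 := by norm_num
    have h5 : Real.exp (1 / 4) ≤ 2 := by
      have h1 := Real.add_one_le_exp (-(1 / 4))
      have h2 : Real.exp (-(1 / 4)) * Real.exp (1 / 4) = 1 := by rw [← Real.exp_add]; simp
      nlinarith [Real.exp_pos (1 / 4)]
    calc _ ≤ 2 * (2 * 16 * m ^ 2) := by
          gcongr
          exact (integral_absPow_mul_exp_quarter_le hp).trans (by gcongr)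
      _ = _ := by ring
  -- The parameter `η ε / (4 m)` is at most `1/4` because `m ≥ η`. The resulting exponent is `-n ε²
  -- η (p/8 - 4η)`, and `η ≤ 1/64` leaves at least `1/16` in the bracket.
  obtain ⟨h1, h2⟩ := integral_exp_mul_le (ν := stdNormal) (g := fun x => |x| ^ p)
    (fun x => by positivity) (integrable_absPow (by linarith)) (l := η / 4 * ε / m) (L := 1 / 4)
    (by positivity) (by rw [div_le_iff₀ hm0]; nlinarith) hL hV le_rfl
  have h3 := measureReal_le_sum_le (n := n) h1 h2
    (η / 4 * ε / m * ((1 + p * ε / 2) * (n * m)))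
  refine (measureReal_mono ?_ (measure_ne_top _ _)).trans (h3.trans (Real.exp_le_exp.2 ?_))
  · intro x hx
    simp only [Set.mem_ofPred_eq] at hx ⊢
    rw [← Finset.mul_sum]
    gcongr
  · rw [show ∫ t, |t| ^ p ∂stdNormal = m from rfl]
    have e : -(η / 4 * ε / m * ((1 + p * ε / 2) * (n * m)))
        + n * (η / 4 * ε / m * m + (η / 4 * ε / m) ^ 2 * (64 * m ^ 2))
        = -(n * ε ^ 2 * η * (p / 8 - 4 * η)) := by
      field_simp
      ring
    rw [e, neg_le_neg_iff]
    have : 0 ≤ n * ε ^ 2 * η := by positivity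
    nlinarith

theorem measureReal_lt_absPow_le {T : ℝ} (hp : 0 < p) (hT : 0 ≤ T) :
    stdNormal.real {x | T < |x| ^ p} ≤ 2 * Real.exp (-(T ^ (2 / p) / 4)) := by
  have h0 := integral_absPow_mul_exp_quarter (q := 0) le_rfl
  have hi := integrable_absPow_mul_exp (q := 0) (s := 1 / 4) le_rfl (by norm_num)
  simp only [Real.rpow_zero, one_mul, absMoment, integral_const, probReal_univ, smul_eq_mul,
    mul_one] at h0 hi
  have h2 : (2 : ℝ) ^ ((0 + 1 : ℝ) / 2) ≤ 2 := by
    calc (2 : ℝ) ^ ((0 + 1 : ℝ) / 2) ≤ 2 ^ (1 : ℝ) := by gcongr <;> norm_num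
      _ = 2 := by norm_num
  have hmk := mul_meas_ge_le_integral_of_nonneg (μ := stdNormal)
    (Filter.Eventually.of_forall fun x => (Real.exp_pos (1 / 4 * x ^ 2)).le) hi
    (Real.exp (T ^ (2 / p) / 4))
  rw [Real.exp_neg, ← div_eq_mul_inv, le_div_iff₀ (Real.exp_pos _), mul_comm]
  refine le_trans (mul_le_mul_of_nonneg_left (measureReal_mono ?_ (measure_ne_top _ _))
    (Real.exp_pos _).le) (hmk.trans (by linarith))
  intro x hx
  simp only [Set.mem_ofPred_eq] at hx ⊢
  have h3 := Real.rpow_le_rpow hT (le_of_lt hx) (show 0 ≤ 2 / p by positivity)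
  rw [← Real.rpow_mul (abs_nonneg x), mul_div_cancel₀ _ hp.ne', Real.rpow_two, sq_abs] at h3
  gcongr
  linarith

theorem measureReal_exists_le {α : Type*} [MeasurableSpace α] {ν : Measure α}
    [IsProbabilityMeasure ν] {s : Set α} (hs : MeasurableSet s) :
    (Measure.pi fun _ => ν).real {x : Fin n → α | ∃ i, x i ∈ s} ≤ n * ν.real s := by
  have h : {x : Fin n → α | ∃ i, x i ∈ s} = ⋃ i, (fun x => x i) ⁻¹' s := by ext; simp
  rw [h]
  refine (measureReal_iUnion_fintype_le _).trans ?_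
  have (i : Fin n) : (Measure.pi fun _ : Fin n => ν).real ((fun x => x i) ⁻¹' s) = ν.real s :=
    (measurePreserving_eval (fun _ : Fin n => ν) i).measureReal_preimage hs.nullMeasurableSet
  simp [this]

/-- Truncate each `|x i|^p` at `T`, the whole allowed excess of the sum. A union bound handles
larger terms, its factor `n` being absorbed by `hlog`; the truncated terms have exponential moments
up to order `L = T^{2/p - 1} / 4`. -/
theorem measureReal_le_sum_absPow_of_two_le (hp : 2 ≤ p) (hn : 1 ≤ n) {t T : ℝ} (ht : 0 < t)
    (hT : T = t * (n * absMoment p)) (hlog : Real.log n ≤ T ^ (2 / p) / 8) :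
    (gaussPi n).real {x | (1 + t) * (n * absMoment p) ≤ ∑ i, |x i| ^ p}
      ≤ 2 * Real.exp (-(T ^ (2 / p) / 8))
        + Real.exp (-min (T ^ (2 / p) / 8) (n * t ^ 2 / (8 * 4 ^ p))) := by
  have hp0 : 0 < p := by linarith
  have hp1 : 1 ≤ p := by linarith
  have hm := absMoment_pos (show 0 ≤ p by linarith)
  have hn' : (0 : ℝ) < n := by exact_mod_cast hn
  set m := absMoment p with hmdef
  have hT0 : 0 < T := by rw [hT]; positivity
  set g : ℝ → ℝ := {x | |x| ^ p ≤ T}.indicator fun x => |x| ^ p with hgdef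
  have hset : MeasurableSet {x : ℝ | |x| ^ p ≤ T} := measurableSet_le (by fun_prop) measurable_const
  have hg_le (x : ℝ) : g x ≤ |x| ^ p := Set.indicator_le_self' (fun _ _ => by positivity) x
  have hg0 (x : ℝ) : 0 ≤ g x := Set.indicator_nonneg (fun _ _ => by positivity) x
  have hgi : Integrable g stdNormal := (integrable_absPow hp0.le).indicator hset
  have hgm : Measurable g := (by fun_prop : Measurable fun x : ℝ => |x| ^ p).indicator hset
  set L : ℝ := T ^ (2 / p) / (4 * T) with hLdef
  -- As `p ≥ 2`, `y ↦ y^{2/p - 1}` is decreasing, so `T^{2/p - 1} y ≤ y^{2/p} = x²` whenever `y =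
  -- |x|^p ≤ T`.
  have hgL (x : ℝ) : L * g x ≤ 1 / 4 * x ^ 2 := by
    by_cases hx : |x| ^ p ≤ T
    · rw [hgdef, Set.indicator_of_mem (by exact hx)]
      rcases eq_or_ne x 0 with rfl | hx0
      · simp [hp0.ne']
      have ha : 0 < |x| := abs_pos.2 hx0
      have e1 : x ^ 2 = (|x| ^ p) ^ (2 / p) := by
        rw [← Real.rpow_mul ha.le, mul_div_cancel₀ _ hp0.ne', Real.rpow_two, sq_abs]
      have e2 : T ^ (2 / p) * |x| ^ p ≤ (|x| ^ p) ^ (2 / p) * T := by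
        set y := |x| ^ p
        have hy : 0 < y := by positivity
        have h1 : (2 / p - 1) ≤ 0 := by rw [sub_nonpos, div_le_one hp0]; exact hp
        have h2 := Real.rpow_le_rpow_of_nonpos hy hx h1
        rw [Real.rpow_sub_one hy.ne', Real.rpow_sub_one hT0.ne',
          div_le_div_iff₀ hT0 hy] at h2
        exact h2
      rw [hLdef, e1, div_mul_eq_mul_div, div_le_iff₀ (by positivity)]
      linarith
    · rw [hgdef, Set.indicator_of_notMem (by exact hx)]
      nlinarith [sq_nonneg x]
  have hpt (x : ℝ) : g x ^ 2 * Real.exp (L * g x) ≤ |x| ^ (2 * p) * Real.exp (1 / 4 * x ^ 2) := by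
    rw [← sq_absPow]
    exact mul_le_mul (pow_le_pow_left₀ (hg0 x) (hg_le x) 2) (Real.exp_le_exp.2 (hgL x))
      (Real.exp_pos _).le (by positivity)
  have hi := integrable_absPow_mul_exp (q := 2 * p) (s := 1 / 4) (by linarith) (by norm_num)
  have hLi : Integrable (fun x => g x ^ 2 * Real.exp (L * g x)) stdNormal := by
    refine hi.mono' (by fun_prop) (Filter.Eventually.of_forall fun x => ?_)
    rw [Real.norm_of_nonneg (by have := hg0 x; positivity)]
    exact hpt x
  set V := 2 * 4 ^ p * m ^ 2 with hVdef
  have hV : ∫ x, g x ^ 2 * Real.exp (L * g x) ∂stdNormal ≤ V :=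
    (integral_mono hLi hi hpt).trans (integral_absPow_mul_exp_quarter_le hp1)
  have hmean : ∫ x, g x ∂stdNormal ≤ m := integral_mono hgi (integrable_absPow hp0.le) hg_le
  have hV0 : 0 < V := by positivity
  have hL0 : 0 < L := by positivity
  -- The second entry minimises `-l t m + l² V`. For either entry `l V ≤ t m / 2`, so at least half
  -- of the linear gain survives.
  set l := min L (t * m / (2 * V)) with hldef
  have hl0 : 0 ≤ l := by positivity
  obtain ⟨h1, h2⟩ := integral_exp_mul_le hg0 hgi hl0 (min_le_left _ _) hLi hV hmean
  have h3 := measureReal_le_sum_le (n := n) h1 h2 (l * ((1 + t) * (n * m)))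
  have hmain : Real.exp (-(l * ((1 + t) * (n * m))) + n * (l * m + l ^ 2 * V))
      ≤ Real.exp (-min (T ^ (2 / p) / 8) (n * t ^ 2 / (8 * 4 ^ p))) := by
    refine Real.exp_le_exp.2 ?_
    have e1 : l * V ≤ t * m / 2 := by
      calc l * V ≤ t * m / (2 * V) * V := by gcongr; exact min_le_right _ _
        _ = t * m / 2 := by field_simp
    have e2 : l * (t * (n * m)) / 2 = min (T ^ (2 / p) / 8) (n * t ^ 2 / (8 * 4 ^ p)) := by
      rw [hldef, min_mul_of_nonneg _ _ (by positivity), ← min_div_div_right (by norm_num)]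
      congr 1
      · rw [← hT, hLdef]; field_simp; norm_num
      · rw [hVdef]; field_simp; norm_num
    rw [← e2]
    nlinarith [mul_le_mul_of_nonneg_left e1 (show 0 ≤ n * l by positivity)]
  have hsub : {x : Fin n → ℝ | (1 + t) * (n * m) ≤ ∑ i, |x i| ^ p}
      ⊆ {x | ∃ i, x i ∈ {y : ℝ | T < |y| ^ p}}
        ∪ {x | l * ((1 + t) * (n * m)) ≤ ∑ i, l * g (x i)} := by
    intro x hx
    simp only [Set.mem_union, Set.mem_ofPred_eq] at hx ⊢
    by_cases hex : ∃ i, T < |x i| ^ p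
    · exact Or.inl hex
    · right
      push Not at hex
      rw [← Finset.mul_sum]
      have : ∑ i, g (x i) = ∑ i, |x i| ^ p :=
        Finset.sum_congr rfl fun i _ => Set.indicator_of_mem (by exact hex i) _
      rw [this]
      gcongr
  refine (measureReal_mono hsub (measure_ne_top _ _)).trans
    ((measureReal_union_le _ _).trans (add_le_add ?_ (h3.trans hmain)))
  refine (measureReal_exists_le (measurableSet_lt measurable_const (by fun_prop))).trans ?_
  refine (mul_le_mul_of_nonneg_left (measureReal_lt_absPow_le hp0 hT0.le) hn'.le).trans ?_
  have h5 : (n : ℝ) ≤ Real.exp (T ^ (2 / p) / 8) := (Real.le_exp_log _).trans (by gcongr)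
  calc (n : ℝ) * (2 * Real.exp (-(T ^ (2 / p) / 4)))
      ≤ Real.exp (T ^ (2 / p) / 8) * (2 * Real.exp (-(T ^ (2 / p) / 4))) := by gcongr
    _ = 2 * Real.exp (-(T ^ (2 / p) / 8)) := by
      rw [mul_left_comm, ← Real.exp_add]; ring_nf

end UpperTails

/-! ### Concentration for small and moderate exponents. -/

/-- The event that the `ℓ_p` norm is within a factor `1 ± ε` of its Gaussian mean. -/
def nearMean (n : ℕ) (p ε : ℝ) : Set (Fin n → ℝ) :=
  {x | (1 - ε) * (∫ y, (∑ i, |y i| ^ p) ^ (1 / p) ∂gaussPi n) ≤ (∑ i, |x i| ^ p) ^ (1 / p) ∧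
    (∑ i, |x i| ^ p) ^ (1 / p) ≤ (1 + ε) * ∫ y, (∑ i, |y i| ^ p) ^ (1 / p) ∂gaussPi n}

section NearMean

variable {n : ℕ} {p ε : ℝ}

theorem one_sub_mul_exp_nonpos {C x : ℝ} (hC : 3 ≤ C) (hx : x ≤ 1) :
    1 - C * Real.exp (-x) ≤ 0 := by
  have h1 : Real.exp (-1) ≤ Real.exp (-x) := Real.exp_le_exp.2 (by linarith)
  have h2 : Real.exp (-1) * Real.exp 1 = 1 := by rw [← Real.exp_add]; simp
  have h3 : Real.exp 1 ≤ 3 := by linarith [Real.exp_one_lt_d9]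
  nlinarith [Real.exp_pos (-1)]

theorem one_sub_le_measureReal_nearMean_of_le_two (hp : 1 ≤ p) (hp2 : p ≤ 2) (hn : 1 ≤ n)
    (hε : 0 < ε) (hε1 : ε < 1) :
    1 - 5 * Real.exp (-(Real.exp (-5) / 16 * n * ε ^ 2)) ≤ (gaussPi n).real (nearMean n p ε) := by
  have hη := exp_neg_five_lt
  have hη0 := Real.exp_pos (-5)
  have h2p : (2 : ℝ) ^ p ≤ 4 := by
    calc (2 : ℝ) ^ p ≤ 2 ^ (2 : ℝ) := by gcongr; norm_num
      _ = 4 := by norm_num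
  have hnε : 0 ≤ n * ε ^ 2 := by positivity
  rcases lt_or_ge (n * ε ^ 2) (16 * 2 ^ p) with h | h
  · exact (one_sub_mul_exp_nonpos (by norm_num) (by nlinarith)).trans measureReal_nonneg
  · refine le_trans ?_ (one_sub_le_measureReal_near_mean hp hn hε hε1 h
      (measureReal_le_sum_absPow_of_le_two hp hp2 hε hε1))
    have h1 : Real.exp (-(n * ε ^ 2 / (2 * 2 ^ p)))
        ≤ Real.exp (-(Real.exp (-5) / 16 * n * ε ^ 2)) := by
      refine Real.exp_le_exp.2 (neg_le_neg ?_)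
      rw [le_div_iff₀ (by positivity)]
      have : Real.exp (-5) / 16 * (2 * 2 ^ p) ≤ 1 := by nlinarith
      nlinarith
    linarith [Real.exp_pos (-(Real.exp (-5) / 16 * n * ε ^ 2))]

theorem self_le_two_rpow (hp : 1 ≤ p) : p ≤ 2 ^ p := by
  have := one_add_mul_self_le_rpow_one_add (s := 1) (by norm_num) hp
  norm_num at this
  linarith

/-- With `y = log n / p > 16/η`, `exp y ≥ y²/2 ≥ 8y/η`. This supplies the condition under which the
union bound over coordinates is affordable. -/
theorem log_le_of_lt {η : ℝ} (hη : 0 < η) (hp : 0 < p) (hpn : p < η / 16 * Real.log n) :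
    Real.log n ≤ η / 8 * (p * (n : ℝ) ^ (1 / p)) := by
  have hlog : 0 < Real.log n := by
    by_contra h
    have : η / 16 * Real.log n ≤ 0 := mul_nonpos_of_nonneg_of_nonpos (by positivity) (not_lt.1 h)
    linarith
  have hn : (0 : ℝ) < n := by
    rcases Nat.eq_zero_or_pos n with rfl | h
    · simp at hlog
    · exact_mod_cast h
  set y := Real.log n / p with hy
  have hy0 : 0 < y := by positivity
  have e1 : (n : ℝ) ^ (1 / p) = Real.exp y := by
    rw [Real.rpow_def_of_pos hn, hy]; ring_nf
  have e2 : Real.log n = p * y := by rw [hy]; field_simp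
  have h1 := Real.quadratic_le_exp_of_nonneg hy0.le
  have h2 : 1 ≤ η / 16 * y := by
    rw [e2] at hpn
    nlinarith
  rw [e1, e2]
  have h3 : y ≤ η / 8 * Real.exp y := by nlinarith [mul_le_mul_of_nonneg_left h2 hy0.le]
  nlinarith

set_option maxHeartbeats 800000 in
theorem one_sub_le_measureReal_nearMean_of_lt_log (hp : 2 ≤ p) (hn : 1 ≤ n)
    (hpn : p < Real.exp (-5) / 16 * Real.log n) (hε : 0 < ε) (hε1 : ε < 1) :
    1 - 6 * Real.exp (-(Real.exp (-5) / 16 * min (p * (8 : ℝ) ^ (-p) * n * ε ^ 2)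
        (p * (n : ℝ) ^ (2 / p) * ε ^ (2 / p)))) ≤ (gaussPi n).real (nearMean n p ε) := by
  have hη := exp_neg_five_lt
  have hη0 := Real.exp_pos (-5)
  set η := Real.exp (-5) with hηdef
  set X := min (p * (8 : ℝ) ^ (-p) * n * ε ^ 2) (p * (n : ℝ) ^ (2 / p) * ε ^ (2 / p)) with hX
  have hp0 : 0 < p := by linarith
  have hp1 : 1 ≤ p := by linarith
  have hn' : (1 : ℝ) ≤ n := by exact_mod_cast hn
  have hX0 : 0 ≤ X := by positivity
  have hX1 : X ≤ p * (8 : ℝ) ^ (-p) * n * ε ^ 2 := min_le_left _ _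
  have hX2 : X ≤ p * (n : ℝ) ^ (2 / p) * ε ^ (2 / p) := min_le_right _ _
  have hnε : 0 ≤ n * ε ^ 2 := by positivity
  set a : ℝ := 2 ^ p with ha
  have ha1 : p ≤ a := self_le_two_rpow hp1
  have ha0 : 0 < a := by positivity
  have e4 : (4 : ℝ) ^ p = a ^ 2 := by
    rw [ha, ← Real.rpow_natCast, ← Real.rpow_mul (by norm_num), mul_comm, Real.rpow_mul (by norm_num)]
    norm_num
  have e8 : (8 : ℝ) ^ (-p) = (a ^ 3)⁻¹ := by
    rw [Real.rpow_neg (by norm_num), ha, ← Real.rpow_natCast, ← Real.rpow_mul (by norm_num),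
      mul_comm, Real.rpow_mul (by norm_num)]
    norm_num
  rw [e8] at hX1
  -- If the first entry of the minimum is below `16`, the exponent is below `η < 1` and the claim is
  -- void. Otherwise `p ≤ 2^p` gives `n ε² ≥ 16 · 4^p`.
  rcases lt_or_ge (p * (a ^ 3)⁻¹ * n * ε ^ 2) 16 with h | h
  · exact (one_sub_mul_exp_nonpos (by norm_num) (by nlinarith)).trans measureReal_nonneg
  have h16 : 16 * a ^ 3 ≤ p * (n * ε ^ 2) := by
    rw [show p * (a ^ 3)⁻¹ * n * ε ^ 2 = p * (n * ε ^ 2) / a ^ 3 by field_simp,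
      le_div_iff₀ (by positivity)] at h
    exact h
  have h16a : 16 * a ^ 2 ≤ n * ε ^ 2 := by
    have : p * (n * ε ^ 2) ≤ a * (n * ε ^ 2) := by gcongr
    have h2 : a * (16 * a ^ 2) ≤ a * (n * ε ^ 2) := by linarith
    exact le_of_mul_le_mul_left h2 ha0
  have ha2 : 1 ≤ a := by linarith
  have h16b : 16 * a ≤ n * ε ^ 2 := by nlinarith
  have hm := absMoment_pos (show 0 ≤ p by linarith)
  set T := p * ε / 2 * (n * absMoment p) with hT
  have hTB : η * (p * (n : ℝ) ^ (2 / p) * ε ^ (2 / p)) ≤ T ^ (2 / p) := by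
    have h1 : (n * ε) * (η * p) ^ (p / 2) ≤ T := by
      have h2 := absMoment_ge hp1
      calc (n * ε) * (η * p) ^ (p / 2) ≤ (n * ε) * absMoment p := by gcongr
        _ ≤ (p / 2) * ((n * ε) * absMoment p) :=
          le_mul_of_one_le_left (by positivity) (by linarith)
        _ = T := by rw [hT]; ring
    have h3 := Real.rpow_le_rpow (by positivity) h1 (show 0 ≤ 2 / p by positivity)
    rw [Real.mul_rpow (by positivity) (by positivity), Real.mul_rpow (by positivity) hε.le,
      ← Real.rpow_mul (by positivity), show p / 2 * (2 / p) = 1 by field_simp,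
      Real.rpow_one] at h3
    linarith
  have hlog : Real.log n ≤ T ^ (2 / p) / 8 := by
    -- Here `n ε² ≥ 1`, so `(n ε)² ≥ n`.
    have h1 : (n : ℝ) ^ (1 / p) ≤ (n : ℝ) ^ (2 / p) * ε ^ (2 / p) := by
      rw [← Real.mul_rpow (by positivity) hε.le]
      have h2 : (n * ε) ^ (2 / p) = ((n * ε) ^ 2) ^ (1 / p) := by
        rw [← Real.rpow_natCast, ← Real.rpow_mul (by positivity)]
        congr 1
        push_cast
        ring
      rw [h2]
      gcongr
      nlinarith
    have h2 := log_le_of_lt hη0 hp0 hpn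
    have h3 : η / 8 * (p * (n : ℝ) ^ (1 / p))
        ≤ η / 8 * (p * ((n : ℝ) ^ (2 / p) * ε ^ (2 / p))) := by gcongr
    linarith
  refine le_trans ?_ (one_sub_le_measureReal_near_mean hp1 hn hε hε1 h16b
      (measureReal_le_sum_absPow_of_two_le hp hn (by positivity) hT hlog))
  have hX3 : η / 16 * X ≤ n * ε ^ 2 / (2 * a) := by
    rw [le_div_iff₀ (by positivity)]
    have h1 : X * a ≤ n * ε ^ 2 := by
      calc X * a ≤ p * (a ^ 3)⁻¹ * n * ε ^ 2 * a := by gcongr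
        _ = p / a ^ 2 * (n * ε ^ 2) := by field_simp
        _ ≤ 1 * (n * ε ^ 2) := by
          gcongr
          rw [div_le_one (by positivity)]
          nlinarith
        _ = _ := one_mul _
    have h2 : η / 16 * (X * (2 * a)) ≤ 1 / 2 * (X * (2 * a)) :=
      mul_le_mul_of_nonneg_right (by linarith) (by positivity)
    linarith
  have hX4 : η / 16 * X ≤ T ^ (2 / p) / 8 := by
    have : η * X ≤ η * (p * (n : ℝ) ^ (2 / p) * ε ^ (2 / p)) := by gcongr
    linarith [mul_nonneg hη0.le hX0]
  have hX5 : η / 16 * X ≤ n * (p * ε / 2) ^ 2 / (8 * 4 ^ p) := by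
    rw [e4]
    have h1 : X ≤ 32 * (n * (p * ε / 2) ^ 2 / (8 * a ^ 2)) := by
      refine hX1.trans ?_
      rw [show p * (a ^ 3)⁻¹ * n * ε ^ 2 = p * (n * ε ^ 2) * (1 / a) / a ^ 2 by field_simp,
        show 32 * (n * (p * ε / 2) ^ 2 / (8 * a ^ 2)) = p * (n * ε ^ 2) * p / a ^ 2 by
          field_simp; ring]
      gcongr
      exact ((div_le_one ha0).2 ha2).trans hp1
    have h2 : η / 16 * X ≤ 1 / 32 * X := mul_le_mul_of_nonneg_right (by linarith) hX0
    linarith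
  have k1 : Real.exp (-(n * ε ^ 2 / (2 * a))) ≤ Real.exp (-(η / 16 * X)) :=
    Real.exp_le_exp.2 (neg_le_neg hX3)
  have k2 : Real.exp (-(T ^ (2 / p) / 8)) ≤ Real.exp (-(η / 16 * X)) :=
    Real.exp_le_exp.2 (neg_le_neg hX4)
  have k3 : Real.exp (-min (T ^ (2 / p) / 8) (n * (p * ε / 2) ^ 2 / (8 * 4 ^ p)))
      ≤ Real.exp (-(η / 16 * X)) := Real.exp_le_exp.2 (neg_le_neg (le_min hX4 hX5))
  linarith [Real.exp_pos (-(η / 16 * X))]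

end NearMean

/-! ### Large exponents: moments and lower tail at the quantile scale. -/

section LargeExponent

variable {n : ℕ} {p b : ℝ}

theorem Real.sum_rpow_le_sum_rpow_of_le_one {ι : Type*} (s : Finset ι) {f : ι → ℝ}
    (hf : ∀ i, 0 ≤ f i) {r : ℝ} (hr : 0 < r) (hr1 : r ≤ 1) :
    (∑ i ∈ s, f i) ^ r ≤ ∑ i ∈ s, f i ^ r := by
  classical
  induction s using Finset.induction_on with
  | empty => simp [hr.ne']
  | insert i s hi ih =>
    rw [Finset.sum_insert hi, Finset.sum_insert hi]
    exact (Real.rpow_add_le_add_rpow (hf i) (Finset.sum_nonneg fun j _ => hf j) hr.le hr1).trans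
      (by gcongr)

/-- The `p`-th absolute moment of a standard normal variable restricted to `[-b, b]`. -/
noncomputable def truncMoment (b p : ℝ) : ℝ :=
  ∫ x, {x : ℝ | |x| ≤ b}.indicator (fun x => |x| ^ p) x ∂stdNormal

theorem measurableSet_abs_le (b : ℝ) : MeasurableSet {x : ℝ | |x| ≤ b} :=
  measurableSet_le measurable_norm measurable_const

theorem truncMoment_nonneg (b p : ℝ) : 0 ≤ truncMoment b p :=
  integral_nonneg fun x => Set.indicator_nonneg (fun _ _ => by positivity) x

theorem integrable_trunc (hp : 0 ≤ p) :
    Integrable ({x : ℝ | |x| ≤ b}.indicator fun x => |x| ^ p) stdNormal :=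
  (integrable_absPow hp).indicator (measurableSet_abs_le b)

/-- Split the coordinates at `b`; the power `q/p ≤ 1` is subadditive. The part below `b` contributes
at most `1 + 1`, by `y^r ≤ 1 + y`. Each coordinate above `b` contributes `(|x|/b)^q`, with total
expectation at most `2 n P(|Z| > b) ≤ 2`. -/
theorem integral_sum_absPow_div_rpow_le (hp : 1 ≤ p) (hb : 0 < b) (hbn : n * gaussTail b ≤ 1)
    {q : ℝ} (hq : 0 < q) (hqp : q ≤ p) (hqb : q ≤ b ^ 2 / 2) :
    Integrable (fun x : Fin n → ℝ =>
        ((∑ i, |x i| ^ p) / (b ^ p + n * truncMoment b p)) ^ (q / p)) (gaussPi n) ∧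
      ∫ x : Fin n → ℝ, ((∑ i, |x i| ^ p) / (b ^ p + n * truncMoment b p)) ^ (q / p) ∂gaussPi n
        ≤ 4 := by
  have hp0 : 0 < p := by linarith
  set g : ℝ → ℝ := {x : ℝ | |x| ≤ b}.indicator fun x => |x| ^ p with hgdef
  have hg0 (x : ℝ) : 0 ≤ g x := Set.indicator_nonneg (fun _ _ => by positivity) x
  have hgi : Integrable g stdNormal := integrable_trunc hp0.le
  have hm0 := truncMoment_nonneg b p
  set D := b ^ p + n * truncMoment b p with hD
  have hbp : 0 < b ^ p := by positivity
  have hDb : b ^ p ≤ D := le_add_of_nonneg_right (by positivity)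
  have hD0 : 0 < D := hbp.trans_le hDb
  set r := q / p with hr
  have hr0 : 0 < r := by positivity
  have hr1 : r ≤ 1 := (div_le_one hp0).2 hqp
  obtain ⟨hui, hu⟩ := integral_indicator_div_rpow_le hb hq.le hqb
  set u : ℝ → ℝ := {x : ℝ | b < |x|}.indicator fun x => (|x| / b) ^ q with hudef
  have hpt (x : Fin n → ℝ) : ((∑ i, |x i| ^ p) / D) ^ r
      ≤ 1 + (∑ i, g (x i)) / D + ∑ i, u (x i) := by
    set v : ℝ → ℝ := {x : ℝ | b < |x|}.indicator fun x => (|x| / b) ^ p with hvdef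
    have hv0 (x : ℝ) : 0 ≤ v x := Set.indicator_nonneg (fun _ _ => by positivity) x
    have hvu (x : ℝ) : v x ^ r = u x := by
      by_cases hx : b < |x|
      · rw [hvdef, hudef, Set.indicator_of_mem (by exact hx), Set.indicator_of_mem (by exact hx),
          ← Real.rpow_mul (by positivity), hr, mul_div_cancel₀ _ hp0.ne']
      · rw [hvdef, hudef, Set.indicator_of_notMem (by exact hx),
          Set.indicator_of_notMem (by exact hx), Real.zero_rpow hr0.ne']
    have h1 (t : ℝ) : |t| ^ p / D ≤ g t / D + v t := by
      by_cases ht : b < |t|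
      · rw [hvdef, hgdef, Set.indicator_of_notMem (by exact not_le.2 ht),
          Set.indicator_of_mem (by exact ht), zero_div, zero_add,
          Real.div_rpow (abs_nonneg t) hb.le]
        gcongr
      · rw [hgdef, Set.indicator_of_mem (by exact not_lt.1 ht)]
        linarith [hv0 t]
    have h2 : (∑ i, |x i| ^ p) / D ≤ (∑ i, g (x i)) / D + ∑ i, v (x i) := by
      rw [Finset.sum_div, Finset.sum_div, ← Finset.sum_add_distrib]
      exact Finset.sum_le_sum fun i _ => h1 (x i)
    have hG : 0 ≤ (∑ i, g (x i)) / D := div_nonneg (Finset.sum_nonneg fun i _ => hg0 _) hD0.le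
    have hV : 0 ≤ ∑ i, v (x i) := Finset.sum_nonneg fun i _ => hv0 _
    have h3 : ((∑ i, g (x i)) / D) ^ r ≤ 1 + (∑ i, g (x i)) / D := by
      rcases le_total ((∑ i, g (x i)) / D) 1 with h | h
      · linarith [Real.rpow_le_one hG h hr0.le]
      · linarith [Real.rpow_le_self_of_one_le h hr1]
    calc ((∑ i, |x i| ^ p) / D) ^ r ≤ ((∑ i, g (x i)) / D + ∑ i, v (x i)) ^ r := by
          gcongr
      _ ≤ ((∑ i, g (x i)) / D) ^ r + (∑ i, v (x i)) ^ r :=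
          Real.rpow_add_le_add_rpow hG hV hr0.le hr1
      _ ≤ _ := by
          refine add_le_add h3 ((Real.sum_rpow_le_sum_rpow_of_le_one _ (fun i => hv0 _)
            hr0 hr1).trans (le_of_eq ?_))
          simp_rw [hvu]
  have hG := (integrable_sum_comp_eval (n := n) hgi).div_const D
  have hU := integrable_sum_comp_eval (n := n) hui
  have hi : Integrable (fun x : Fin n → ℝ => 1 + (∑ i, g (x i)) / D + ∑ i, u (x i)) (gaussPi n) :=
    ((integrable_const _).add hG).add hU
  have hmeas : Measurable fun x : Fin n → ℝ => ((∑ i, |x i| ^ p) / D) ^ r := by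
    have (i : Fin n) : Measurable fun x : Fin n → ℝ => |x i| := (measurable_pi_apply i).norm
    fun_prop
  have hint : Integrable (fun x : Fin n → ℝ => ((∑ i, |x i| ^ p) / D) ^ r) (gaussPi n) := by
    refine hi.mono' hmeas.aestronglyMeasurable (Filter.Eventually.of_forall fun x => ?_)
    rw [Real.norm_of_nonneg (by positivity)]
    exact hpt x
  refine ⟨hint, (integral_mono hint hi hpt).trans ?_⟩
  rw [integral_add (by fun_prop) hU, integral_add (by fun_prop) hG, integral_div,
    integral_sum_comp_eval hgi, integral_sum_comp_eval hui]
  have h4 : n * truncMoment b p / D ≤ 1 := by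
    rw [div_le_one hD0]
    linarith
  have h5 : (n : ℝ) * ∫ x, u x ∂stdNormal ≤ n * (2 * gaussTail b) := by gcongr
  change ∫ x : Fin n → ℝ, (1 : ℝ) ∂gaussPi n + n * truncMoment b p / D
    + n * ∫ x, u x ∂stdNormal ≤ 4
  simp only [integral_const, probReal_univ, smul_eq_mul, mul_one]
  linarith

theorem measureReal_forall_abs_le (t : ℝ) :
    (gaussPi n).real {x | ∀ i, |x i| ≤ t} ≤ Real.exp (-(n * gaussTail t)) := by
  have h : {x : Fin n → ℝ | ∀ i, |x i| ≤ t} = Set.univ.pi fun _ => {y : ℝ | |y| ≤ t} := by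
    ext; simp
  have hc : {y : ℝ | |y| ≤ t} = {y : ℝ | t < |y|}ᶜ := by ext; simp
  rw [h, Measure.real, Measure.pi_pi, ENNReal.toReal_prod]
  change ∏ _i : Fin n, stdNormal.real {y : ℝ | |y| ≤ t} ≤ _
  rw [hc, probReal_compl_eq_one_sub (measurableSet_lt_abs t), Finset.prod_const, Finset.card_univ,
    Fintype.card_fin]
  have h1 := Real.add_one_le_exp (-gaussTail t)
  have h2 : gaussTail t ≤ 1 := measureReal_le_one
  calc (1 - gaussTail t) ^ n ≤ Real.exp (-gaussTail t) ^ n :=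
        pow_le_pow_left₀ (by linarith) (by linarith) n
    _ = _ := by rw [← Real.exp_nat_mul]; ring_nf

/-- Truncation gives `g² ≤ b^p g`, so the second moment is at most `b^p` times the mean in the
sub-Gaussian lower tail. -/
theorem measureReal_sum_trunc_le (hp : 0 < p) (hb : 0 < b) (hn : 1 ≤ n) :
    (gaussPi n).real {x | ∑ i, {y : ℝ | |y| ≤ b}.indicator (fun y => |y| ^ p) (x i)
        ≤ n * truncMoment b p / 2} ≤ Real.exp (-(n * truncMoment b p / b ^ p / 8)) := by
  have hn' : (0 : ℝ) < n := by exact_mod_cast hn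
  have hbp : 0 < b ^ p := by positivity
  rcases (truncMoment_nonneg b p).eq_or_lt with h0 | hm
  · rw [← h0]
    simp
  set g : ℝ → ℝ := {x : ℝ | |x| ≤ b}.indicator fun x => |x| ^ p with hgdef
  have hg0 (x : ℝ) : 0 ≤ g x := Set.indicator_nonneg (fun _ _ => by positivity) x
  have hgi : Integrable g stdNormal := integrable_trunc hp.le
  have hgb (x : ℝ) : g x ^ 2 ≤ b ^ p * g x := by
    rw [sq]
    refine mul_le_mul_of_nonneg_right ?_ (hg0 x)
    refine Set.indicator_apply_le' (fun hx => ?_) (fun _ => hbp.le)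
    exact Real.rpow_le_rpow (abs_nonneg x) hx hp.le
  have hg2 : Integrable (fun x => g x ^ 2) stdNormal := by
    refine (hgi.const_mul (b ^ p)).mono' (hgi.aestronglyMeasurable.pow 2)
      (Filter.Eventually.of_forall fun x => ?_)
    rw [Real.norm_of_nonneg (by positivity)]
    exact hgb x
  have hv : ∫ x, g x ^ 2 ∂stdNormal ≤ b ^ p * truncMoment b p := by
    refine (integral_mono hg2 (hgi.const_mul _) hgb).trans_eq ?_
    rw [integral_const_mul]
    rfl
  have h := measureReal_sum_le_sub (n := n) hg0 hgi hg2 hv (by positivity) hn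
    (y := n * truncMoment b p / 2) (by positivity)
  convert h using 2
  · ext x
    simp only [Set.mem_ofPred_eq]
    rw [show ∫ t, g t ∂stdNormal = truncMoment b p from rfl]
    ring_nf
  · field_simp
    norm_num

/-- Either `b^p` nearly exhausts `D`, and a small sum forces every coordinate below `(1 - d/2) b`;
or the truncated mean is at least `p d / 2` times `b^p`, and the truncated sum must fall to half its
mean. -/
theorem measureReal_sum_absPow_lt_le (hp : 1 ≤ p) (hb : 0 < b) (hn : 1 ≤ n)
    (hbn : n * gaussTail b = 1) {d k : ℝ} (hd : 0 < d) (hd1 : d < 1) (hkp : k ≤ p / 16)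
    (hkb : k ≤ b ^ 2 / 4) :
    (gaussPi n).real {x | ∑ i, |x i| ^ p < (1 - d) ^ p * (b ^ p + n * truncMoment b p)}
      ≤ 2 * Real.exp (-(k * d)) := by
  have hp0 : 0 < p := by linarith
  have hn' : (0 : ℝ) < n := by exact_mod_cast hn
  have hbp : 0 < b ^ p := by positivity
  have hm0 := truncMoment_nonneg b p
  have hpow0 : 0 ≤ (1 - d) ^ p := Real.rpow_nonneg (by linarith) _
  -- For `p d < 2`, `k d ≤ 1/8` and the right side exceeds `1`.
  rcases lt_or_ge (p * d) 2 with hpd | hpd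
  · refine measureReal_le_one.trans ?_
    have h1 := Real.add_one_le_exp (-(k * d))
    nlinarith
  rcases le_or_gt (b ^ p + n * truncMoment b p) ((1 + d / 2) ^ p * b ^ p) with hD | hD
  · have hsub : {x : Fin n → ℝ | ∑ i, |x i| ^ p < (1 - d) ^ p * (b ^ p + n * truncMoment b p)}
        ⊆ {x | ∀ i, |x i| ≤ (1 - d / 2) * b} := by
      intro x hx i
      simp only [Set.mem_ofPred_eq] at hx
      have h1 : |x i| ^ p ≤ ((1 - d / 2) * b) ^ p := by
        calc |x i| ^ p ≤ ∑ i, |x i| ^ p :=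
              Finset.single_le_sum (f := fun i => |x i| ^ p) (fun j _ => by positivity)
                (Finset.mem_univ i)
          _ ≤ (1 - d) ^ p * ((1 + d / 2) ^ p * b ^ p) := hx.le.trans (by gcongr)
          _ = ((1 - d) * (1 + d / 2) * b) ^ p := by
              rw [← Real.mul_rpow (by positivity) hb.le, ← Real.mul_rpow (by linarith)
                (by positivity)]
              ring_nf
          _ ≤ ((1 - d / 2) * b) ^ p := by
              have : 0 ≤ 1 - d := by linarith
              gcongr
              nlinarith
      exact (Real.rpow_le_rpow_iff (abs_nonneg _) (mul_nonneg (by linarith) hb.le) hp0).1 h1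
    refine (measureReal_mono hsub (measure_ne_top _ _)).trans
      ((measureReal_forall_abs_le _).trans ?_)
    have h1 := exp_mul_gaussTail_le_scale hb.le (show 0 ≤ d / 2 by linarith) (by linarith)
    have h2 : Real.exp (b ^ 2 * (d / 2) / 2) ≤ n * gaussTail ((1 - d / 2) * b) := by
      calc Real.exp (b ^ 2 * (d / 2) / 2)
          = n * (Real.exp (b ^ 2 * (d / 2) / 2) * gaussTail b) := by
            rw [mul_left_comm, hbn, mul_one]
        _ ≤ _ := by gcongr
    have h3 := Real.add_one_le_exp (b ^ 2 * (d / 2) / 2)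
    have h4 : Real.exp (-(n * gaussTail ((1 - d / 2) * b))) ≤ Real.exp (-(k * d)) := by
      refine Real.exp_le_exp.2 (neg_le_neg ?_)
      nlinarith
    linarith [Real.exp_pos (-(k * d))]
  · have hbern := one_add_mul_self_le_rpow_one_add (s := d / 2) (by linarith) hp
    have h1 : p * d / 2 ≤ n * truncMoment b p / b ^ p := by
      rw [le_div_iff₀ hbp]
      nlinarith
    -- Since `b^p` is at most the truncated mean sum, `D` is at most twice that sum, so the factor
    -- `1/4` puts the threshold below half of it.
    have h2 : (1 - d) ^ p ≤ 1 / 4 := by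
      have h3 : (1 - d) ^ p ≤ Real.exp (-d) ^ p :=
        Real.rpow_le_rpow (by linarith) (by linarith [Real.add_one_le_exp (-d)]) hp0.le
      rw [← Real.exp_mul] at h3
      have h4 : Real.exp (-d * p) ≤ Real.exp (-2) := Real.exp_le_exp.2 (by linarith)
      have h5 : Real.exp (-2) * Real.exp 1 ^ 2 = 1 := by
        rw [← Real.exp_nat_mul, ← Real.exp_add]; norm_num
      have h6 : (4 : ℝ) ≤ Real.exp 1 ^ 2 := by nlinarith [Real.exp_one_gt_d9]
      nlinarith [Real.exp_pos (-2)]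
    have h7 : b ^ p ≤ n * truncMoment b p := by
      have := (le_div_iff₀ hbp).1 h1
      nlinarith
    have hsub : {x : Fin n → ℝ | ∑ i, |x i| ^ p < (1 - d) ^ p * (b ^ p + n * truncMoment b p)}
        ⊆ {x | ∑ i, {y : ℝ | |y| ≤ b}.indicator (fun y => |y| ^ p) (x i)
          ≤ n * truncMoment b p / 2} := by
      intro x hx
      simp only [Set.mem_ofPred_eq] at hx ⊢
      have h8 : ∑ i, {y : ℝ | |y| ≤ b}.indicator (fun y => |y| ^ p) (x i) ≤ ∑ i, |x i| ^ p :=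
        Finset.sum_le_sum fun i _ => Set.indicator_le_self' (fun _ _ => by positivity) _
      nlinarith
    refine (measureReal_mono hsub (measure_ne_top _ _)).trans
      ((measureReal_sum_trunc_le hp0 hb hn).trans ?_)
    have h4 : Real.exp (-(n * truncMoment b p / b ^ p / 8)) ≤ Real.exp (-(k * d)) :=
      Real.exp_le_exp.2 (neg_le_neg (by nlinarith))
    linarith [Real.exp_pos (-(k * d))]

end LargeExponent

/-! ### Large exponents: location of the mean and concentration. -/

section LargeExponent

variable {n : ℕ} {p ε : ℝ}

/-- If the lower deviations of a nonnegative variable `Y` below `1` have an exponential tail of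
rate `k`, then its mean is at least `1 - 2 / k`. -/
theorem one_sub_le_integral_of_lower_tail {α : Type*} [MeasurableSpace α] {μ : Measure α}
    [IsProbabilityMeasure μ] {Y : α → ℝ} (hY : Integrable Y μ) (hY0 : ∀ x, 0 ≤ Y x) {k : ℝ}
    (hk : 0 < k)
    (h : ∀ d, 0 < d → d < 1 → μ.real {x | Y x < 1 - d} ≤ 2 * Real.exp (-(k * d))) :
    1 - 2 / k ≤ ∫ x, Y x ∂μ := by
  have hi : Integrable (fun x => max (1 - Y x) 0) μ := ((integrable_const _).sub hY).pos_part
  have hexp : IntegrableOn (fun d => 2 * Real.exp (-k * d)) (Set.Ioi 0) :=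
    (integrableOn_exp_mul_Ioi (by linarith) 0).const_mul 2
  have h1 : ∫ x, max (1 - Y x) 0 ∂μ ≤ 2 / k := by
    rw [hi.integral_eq_integral_meas_lt (Filter.Eventually.of_forall fun x => le_max_right _ _)]
    calc ∫ t in Set.Ioi 0, μ.real {a | t < max (1 - Y a) 0}
        ≤ ∫ t in Set.Ioi 0, 2 * Real.exp (-k * t) := by
          refine integral_mono_of_nonneg (Filter.Eventually.of_forall fun _ => measureReal_nonneg)
            hexp ?_
          filter_upwards [ae_restrict_mem measurableSet_Ioi] with t ht
          have ht0 : 0 < t := ht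
          rcases lt_or_ge t 1 with ht1 | ht1
          · refine (measureReal_mono ?_ (measure_ne_top _ _)).trans
              ((h t ht0 ht1).trans_eq (by rw [neg_mul]))
            intro x hx
            simp only [Set.mem_ofPred_eq, lt_max_iff] at hx ⊢
            rcases hx with hx | hx <;> linarith
          · have : {a | t < max (1 - Y a) 0} = ∅ := by
              ext x
              simp only [Set.mem_ofPred_eq, Set.mem_empty_iff_false, iff_false, not_lt]
              exact max_le (by linarith [hY0 x]) ht0.le
            rw [this]
            simp only [measureReal_empty]
            positivity
      _ = 2 / k := by
          rw [integral_const_mul, integral_exp_mul_Ioi (by linarith)]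
          simp
          ring
  have h2 : ∫ x, (1 - max (1 - Y x) 0) ∂μ ≤ ∫ x, Y x ∂μ :=
    integral_mono ((integrable_const _).sub hi) hY fun x => by
      have := le_max_left (1 - Y x) 0
      simp only
      linarith
  rw [integral_sub (by fun_prop) hi] at h2
  simp only [integral_const, probReal_univ, smul_eq_mul, mul_one] at h2
  linarith

/-- Bernoulli's inequality `Y^q ≥ 1 + q (Y - 1)`, integrated. -/
theorem integral_le_of_integral_rpow_le {α : Type*} [MeasurableSpace α] {μ : Measure α}
    [IsProbabilityMeasure μ] {Y : α → ℝ} (hY : Integrable Y μ) (hY0 : ∀ x, 0 ≤ Y x) {q A : ℝ}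
    (hq : 1 ≤ q) (hi : Integrable (fun x => Y x ^ q) μ) (hA : ∫ x, Y x ^ q ∂μ ≤ A) :
    ∫ x, Y x ∂μ ≤ 1 + A / q := by
  have hq0 : 0 < q := by linarith
  have hpt (x : α) : Y x ≤ 1 + Y x ^ q / q := by
    have h := one_add_mul_self_le_rpow_one_add (s := Y x - 1) (by linarith [hY0 x]) hq
    rw [add_sub_cancel] at h
    rw [← sub_le_iff_le_add', le_div_iff₀ hq0]
    linarith
  have h1 : ∫ x, Y x ∂μ ≤ ∫ x, (1 + Y x ^ q / q) ∂μ :=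
    integral_mono hY ((integrable_const _).add (hi.div_const q)) hpt
  refine h1.trans ?_
  rw [integral_add (by fun_prop) (by fun_prop), integral_div]
  simp only [integral_const, probReal_univ, smul_eq_mul, mul_one]
  gcongr

theorem measureReal_ge_le_of_integral_rpow_le {α : Type*} [MeasurableSpace α] {μ : Measure α}
    [IsProbabilityMeasure μ] {Y : α → ℝ} (hY0 : ∀ x, 0 ≤ Y x) {q A s : ℝ} (hq : 0 ≤ q)
    (hi : Integrable (fun x => Y x ^ q) μ) (hA : ∫ x, Y x ^ q ∂μ ≤ A) (hs : 0 ≤ s) (hs1 : s ≤ 1) :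
    μ.real {x | 1 + s ≤ Y x} ≤ A * Real.exp (-(q * s / 2)) := by
  have hm := mul_meas_ge_le_integral_of_nonneg (μ := μ)
    (Filter.Eventually.of_forall fun x => Real.rpow_nonneg (hY0 x) q) hi (Real.exp (q * s / 2))
  rw [Real.exp_neg, ← div_eq_mul_inv, le_div_iff₀ (Real.exp_pos _), mul_comm]
  refine le_trans (mul_le_mul_of_nonneg_left (measureReal_mono ?_ (measure_ne_top _ _))
    (Real.exp_pos _).le) (hm.trans hA)
  intro x hx
  simp only [Set.mem_ofPred_eq] at hx ⊢
  have h1 : Real.exp (s / 2) ≤ 1 + s := by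
    have h2 := Real.add_one_le_exp (-(s / 2))
    have h3 : Real.exp (-(s / 2)) * Real.exp (s / 2) = 1 := by rw [← Real.exp_add]; simp
    have h4 := Real.exp_pos (s / 2)
    nlinarith [mul_nonneg hs (sub_nonneg.2 hs1)]
  calc Real.exp (q * s / 2) = Real.exp (s / 2) ^ q := by rw [← Real.exp_mul]; ring_nf
    _ ≤ Y x ^ q := Real.rpow_le_rpow (Real.exp_pos _).le (h1.trans hx) hq

set_option maxHeartbeats 800000 in
theorem one_sub_le_measureReal_nearMean_of_log_le {a : ℝ} (ha0 : 0 < a) (ha : a ≤ 1 / 4)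
    (hp : 1 ≤ p) (hn : 1 ≤ n) (hpn : a * Real.log n ≤ p) (hε : 0 < ε) (hε1 : ε < 1) :
    1 - 6 * Real.exp (-(a / 128 * (ε * Real.log n))) ≤ (gaussPi n).real (nearMean n p ε) := by
  have hp0 : 0 < p := by linarith
  have hn' : (1 : ℝ) ≤ n := by exact_mod_cast hn
  have hlog0 : 0 ≤ Real.log n := Real.log_nonneg hn'
  -- Outside the void case `q ε ≥ 128` and `k ε ≥ 8`, which makes the errors `2/k` and `4/q` in the
  -- mean at most `ε/4` and `ε/2`.
  rcases lt_or_ge (a / 128 * (ε * Real.log n)) 1 with hsmall | hlarge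
  · exact (one_sub_mul_exp_nonpos (by norm_num) hsmall.le).trans measureReal_nonneg
  have hεl : ε * Real.log n ≤ Real.log n := mul_le_of_le_one_left hlog0 hε1.le
  have hal : 128 ≤ a * Real.log n := by nlinarith
  have hlog4 : 4 ≤ Real.log n := by nlinarith
  obtain ⟨b, hb0, hb⟩ := exists_gaussTail_eq (y := 1 / n) (by positivity)
    ((div_le_one (by linarith)).2 hn')
  have hbn : n * gaussTail b = 1 := by rw [hb]; field_simp
  have hb2 : Real.log n / 2 ≤ b ^ 2 := by
    have h1 := gaussTail_ge hb0
    rw [hb, one_div, ← Real.exp_log (show (0 : ℝ) < n by linarith), ← Real.exp_neg,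
      Real.exp_le_exp] at h1
    linarith
  have hbpos : 0 < b := by
    refine hb0.lt_of_ne' fun h => ?_
    rw [h] at hb2
    norm_num at hb2
    linarith
  set q := a * Real.log n with hq
  set k := q / 16 with hk
  have hk0 : 0 < k := by positivity
  have hqb : q ≤ b ^ 2 / 2 := by nlinarith
  set D := b ^ p + n * truncMoment b p with hD
  have hD0 : 0 < D := by have := truncMoment_nonneg b p; positivity
  set M := D ^ (1 / p) with hM
  have hM0 : 0 < M := by positivity
  set N : (Fin n → ℝ) → ℝ := fun x => (∑ i, |x i| ^ p) ^ (1 / p) with hN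
  have hNi : Integrable N (gaussPi n) := integrable_sum_absPow_rpow hp
  have hN0 (x : Fin n → ℝ) : 0 ≤ N x := by positivity
  set Y : (Fin n → ℝ) → ℝ := fun x => N x / M with hY
  have hYi : Integrable Y (gaussPi n) := hNi.div_const _
  have hY0 (x : Fin n → ℝ) : 0 ≤ Y x := div_nonneg (hN0 x) hM0.le
  have hYD (x : Fin n → ℝ) : Y x = ((∑ i, |x i| ^ p) / D) ^ (1 / p) :=
    (Real.div_rpow (by positivity) hD0.le _).symm
  have hYp (x : Fin n → ℝ) : Y x ^ p = (∑ i, |x i| ^ p) / D := by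
    rw [hYD, ← Real.rpow_mul (by positivity), one_div_mul_cancel hp0.ne', Real.rpow_one]
  have hYq (x : Fin n → ℝ) : Y x ^ q = ((∑ i, |x i| ^ p) / D) ^ (q / p) := by
    rw [hYD, ← Real.rpow_mul (by positivity), one_div_mul_eq_div]
  obtain ⟨hqi, hqA⟩ := integral_sum_absPow_div_rpow_le hp hbpos hbn.le (by positivity) hpn hqb
  simp_rw [← hD, ← hYq] at hqi hqA
  have htail (d : ℝ) (hd : 0 < d) (hd1 : d < 1) :
      (gaussPi n).real {x | Y x < 1 - d} ≤ 2 * Real.exp (-(k * d)) := by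
    refine (measureReal_mono ?_ (measure_ne_top _ _)).trans (measureReal_sum_absPow_lt_le hp hbpos
      hn hbn hd hd1 (by rw [hk]; gcongr) (by rw [hk]; linarith))
    intro x hx
    simp only [Set.mem_ofPred_eq] at hx ⊢
    have := Real.rpow_lt_rpow (hY0 x) hx hp0
    rwa [hYp, div_lt_iff₀ hD0] at this
  have hlo := one_sub_le_integral_of_lower_tail hYi hY0 hk0 htail
  have hup := integral_le_of_integral_rpow_le hYi hY0 (by linarith) hqi hqA
  set E := ∫ x, Y x ∂gaussPi n with hE
  have hEN : ∫ x, N x ∂gaussPi n = M * E := by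
    rw [hE, hY, integral_div, mul_div_cancel₀ _ hM0.ne']
  have hkε : 8 ≤ k * ε := by nlinarith
  have hqε : 128 ≤ q * ε := by nlinarith
  have hlo' : 1 - ε / 4 ≤ E := by
    have : 2 / k ≤ ε / 4 := by
      rw [div_le_div_iff₀ hk0 (by norm_num)]
      linarith
    linarith
  have hup' : E ≤ 1 + ε / 2 := by
    have : 4 / q ≤ ε / 2 := by
      rw [div_le_div_iff₀ (by linarith) (by norm_num)]
      linarith
    linarith
  have hA := htail (ε / 2) (by linarith) (by linarith)
  have hB := measureReal_ge_le_of_integral_rpow_le hY0 (by linarith) hqi hqA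
    (show 0 ≤ ε / 2 by linarith) (by linarith)
  have hcompl : (nearMean n p ε)ᶜ ⊆ {x | Y x < 1 - ε / 2} ∪ {x | 1 + ε / 2 ≤ Y x} := by
    intro x hx
    simp only [nearMean, Set.mem_compl_iff, Set.mem_ofPred_eq, not_and_or, not_le] at hx
    change N x < (1 - ε) * (∫ y, N y ∂gaussPi n) ∨ (1 + ε) * (∫ y, N y ∂gaussPi n) < N x at hx
    rw [hEN, show N x = M * Y x from (mul_div_cancel₀ _ hM0.ne').symm, mul_left_comm,
      mul_left_comm (1 + ε), mul_lt_mul_iff_right₀ hM0, mul_lt_mul_iff_right₀ hM0] at hx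
    simp only [Set.mem_union, Set.mem_ofPred_eq]
    rcases hx with hx | hx
    · left
      nlinarith
    · right
      nlinarith
  refine le_trans ?_ (one_sub_le_measureReal_of_compl_subset (measurableSet_mem_interval n p _ _)
    hcompl hA hB)
  have e1 : Real.exp (-(k * (ε / 2))) ≤ Real.exp (-(a / 128 * (ε * Real.log n))) :=
    Real.exp_le_exp.2 (neg_le_neg (by nlinarith))
  have e2 : Real.exp (-(q * (ε / 2) / 2)) ≤ Real.exp (-(a / 128 * (ε * Real.log n))) :=
    Real.exp_le_exp.2 (neg_le_neg (by nlinarith))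
  linarith

end LargeExponent

/-! ### The intermediate window, transfer to a general probability space, and assembly. -/

theorem one_sub_le_measureReal_nearMean_of_const_mul_log_le {n : ℕ} {p ε : ℝ} (hp : 1 ≤ p)
    (hn : 1 ≤ n) (hpn : Real.exp (-5) / 2048 * Real.log n ≤ p) (hε : 0 < ε) (hε1 : ε < 1) :
    1 - 8 * Real.exp (-(Real.exp (-5) / 2048 * (ε * Real.log n)))
      ≤ (gaussPi n).real (nearMean n p ε) := by
  have hη := exp_neg_five_lt
  have hη0 := Real.exp_pos (-5)
  set η := Real.exp (-5)
  have hp0 : 0 < p := by linarith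
  have hn' : (1 : ℝ) ≤ n := by exact_mod_cast hn
  have hlog0 : 0 ≤ Real.log n := Real.log_nonneg hn'
  set l := Real.log n with hl
  have hεl : ε * l ≤ l := mul_le_of_le_one_left hlog0 hε1.le
  set X := Real.exp (-(η / 2048 * (ε * l))) with hX
  have hX0 : 0 < X := Real.exp_pos _
  rcases lt_or_ge p (η / 16 * l) with hlt | hge
  · rcases lt_or_ge (η / 2048 * (ε * l)) 1 with hsmall | hlarge
    · exact (one_sub_mul_exp_nonpos (by norm_num) hsmall.le).trans measureReal_nonneg
    rcases lt_or_ge p 2 with hp2 | hp2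
    -- When `p < 2`, the hypothesis bounds `log n`, and `exp 2 ≤ 8` makes the claim void; this is
    -- where `C = 8` is used.
    · have h1 : η / 2048 * (ε * l) ≤ 2 := by nlinarith
      have h2 : Real.exp (-2) ≤ X := Real.exp_le_exp.2 (by linarith)
      have h3 : Real.exp (-2) * Real.exp 1 ^ 2 = 1 := by
        rw [← Real.exp_nat_mul, ← Real.exp_add]; norm_num
      have h4 : Real.exp 1 ^ 2 ≤ 8 := by nlinarith [Real.exp_one_lt_d9, Real.exp_pos 1]
      have h5 : 1 ≤ 8 * X := by nlinarith [Real.exp_pos (-2)]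
      exact (show 1 - 8 * X ≤ 0 by linarith).trans measureReal_nonneg
    · refine le_trans ?_ (one_sub_le_measureReal_nearMean_of_lt_log hp2 hn hlt hε hε1)
      set W := min (p * (8 : ℝ) ^ (-p) * n * ε ^ 2) (p * (n : ℝ) ^ (2 / p) * ε ^ (2 / p))
      have hεl1 : 1 ≤ ε * l := by nlinarith
      -- Because `p` is a small multiple of `log n`, `8^{-p} ≥ n^{-1/2}`. Hence `8^{-p} n ≥ √n ≥
      -- (log n)² / 8`.
      have hW1 : ε * l / 8 ≤ p * (8 : ℝ) ^ (-p) * n * ε ^ 2 := by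
        have h8 : Real.exp (-(l / 2)) ≤ (8 : ℝ) ^ (-p) := by
          rw [Real.rpow_def_of_pos (by norm_num), Real.exp_le_exp]
          have h2 : Real.log 8 ≤ 7 := by
            linarith [Real.log_le_sub_one_of_pos (show (0 : ℝ) < 8 by norm_num)]
          nlinarith
        have h9 : (n : ℝ) = Real.exp (l / 2) * Real.exp (l / 2) := by
          rw [← Real.exp_add, add_halves, hl, Real.exp_log (by linarith)]
        have h10 : Real.exp (l / 2) ≤ (8 : ℝ) ^ (-p) * n := by
          calc Real.exp (l / 2)
              = Real.exp (-(l / 2)) * (Real.exp (l / 2) * Real.exp (l / 2)) := by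
                rw [← mul_assoc, ← Real.exp_add]; simp
            _ = Real.exp (-(l / 2)) * n := by rw [← h9]
            _ ≤ _ := by gcongr
        have h11 := Real.quadratic_le_exp_of_nonneg (show 0 ≤ l / 2 by linarith)
        have h12 : l ^ 2 / 8 ≤ (8 : ℝ) ^ (-p) * n := by nlinarith
        calc ε * l / 8 ≤ (ε * l) ^ 2 / 8 := by nlinarith
          _ = 1 * (l ^ 2 / 8) * ε ^ 2 := by ring
          _ ≤ p * ((8 : ℝ) ^ (-p) * n) * ε ^ 2 := by gcongr
          _ = _ := by ring
      have hW2 : ε * l / 8 ≤ p * (n : ℝ) ^ (2 / p) * ε ^ (2 / p) := by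
        have h1 : 2 / p * l ≤ (n : ℝ) ^ (2 / p) := by
          rw [Real.rpow_def_of_pos (by linarith), mul_comm]
          linarith [Real.add_one_le_exp (Real.log n * (2 / p))]
        have h2 : ε ≤ ε ^ (2 / p) :=
          Real.self_le_rpow_of_le_one hε.le hε1.le ((div_le_one hp0).2 hp2)
        calc ε * l / 8 ≤ p * (2 / p * l) * ε := by
              rw [← mul_assoc, mul_div_cancel₀ _ hp0.ne']
              nlinarith
          _ ≤ _ := by gcongr
      have hW : ε * l / 8 ≤ W := le_min hW1 hW2
      have h1 : Real.exp (-(η / 16 * W)) ≤ X := by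
        refine Real.exp_le_exp.2 (neg_le_neg ?_)
        nlinarith [mul_le_mul_of_nonneg_left hW hη0.le]
      linarith
  -- With `a = η / 16` the rate `a / 128` is exactly `η / 2048`, which fixes `c`.
  · have h := one_sub_le_measureReal_nearMean_of_log_le (a := η / 16) (by positivity)
      (by linarith) hp hn hge hε hε1
    rw [div_div] at h
    norm_num only at h
    linarith

theorem integrable_ellNorm_and_measureReal_eq {n : ℕ} {p : ℝ} (hp : 1 ≤ p) (ε : ℝ)
    {Ω : Type*} [MeasurableSpace Ω] {P : Measure Ω} {Z : Ω → EuclideanSpace ℝ (Fin n)}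
    (hZ : HasLaw Z (stdGaussian (EuclideanSpace ℝ (Fin n))) P) :
    Integrable (fun ω => ellNorm p (Z ω)) P ∧
      P.real {ω | (1 - ε) * (∫ ω', ellNorm p (Z ω') ∂P) ≤ ellNorm p (Z ω) ∧
        ellNorm p (Z ω) ≤ (1 + ε) * (∫ ω', ellNorm p (Z ω') ∂P)}
        = (gaussPi n).real (nearMean n p ε) := by
  have hp0 : 0 < p := by linarith
  have hX : HasLaw (fun ω => WithLp.ofLp (Z ω)) (gaussPi n) P := by
    refine ⟨(by fun_prop : Measurable (WithLp.ofLp : EuclideanSpace ℝ (Fin n) →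
      Fin n → ℝ)).comp_aemeasurable hZ.aemeasurable, ?_⟩
    have h := AEMeasurable.map_map_of_aemeasurable (μ := P) (f := Z)
      (g := (WithLp.ofLp : EuclideanSpace ℝ (Fin n) → Fin n → ℝ))
      (by fun_prop : Measurable _).aemeasurable hZ.aemeasurable
    change P.map ((WithLp.ofLp : EuclideanSpace ℝ (Fin n) → Fin n → ℝ) ∘ Z) = _
    rw [← h, hZ.map_eq, ← map_pi_eq_stdGaussian, Measure.map_map (by fun_prop) (by fun_prop)]
    exact Measure.map_id
  have hmeas := measurable_sum_absPow_rpow n p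
  simp_rw [ellNorm_eq hp0]
  have hint : ∫ ω, (∑ i, |Z ω i| ^ p) ^ (1 / p) ∂P
      = ∫ x, (∑ i, |x i| ^ p) ^ (1 / p) ∂gaussPi n := by
    rw [← hX.map_eq, integral_map hX.aemeasurable hmeas.aestronglyMeasurable]
  have hi := integrable_sum_absPow_rpow (n := n) hp
  rw [← hX.map_eq] at hi
  refine ⟨hi.comp_aemeasurable hX.aemeasurable, ?_⟩
  have key := Measure.map_apply_of_aemeasurable hX.aemeasurable
    (s := nearMean n p ε) (measurableSet_mem_interval n p _ _)
  rw [hX.map_eq] at key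
  rw [hint, Measure.real, Measure.real, key]
  rfl

theorem mainTheorem9 :
    ∃ C c : ℝ, 0 < C ∧ 0 < c ∧
      ∀ (n : ℕ) (_ : 1 ≤ n) (p : ℝ) (_ : 1 ≤ p) (ε : ℝ) (_ : 0 < ε) (_ : ε < 1)
        {Ω : Type*} [MeasurableSpace Ω] (P : Measure Ω) [IsProbabilityMeasure P]
        (Z : Ω → EuclideanSpace ℝ (Fin n))
        (_ : HasLaw Z (stdGaussian (EuclideanSpace ℝ (Fin n))) P),
        Integrable (fun ω => ellNorm p (Z ω)) P ∧
        (p ≤ 2 →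
          1 - C * Real.exp (-(c * n * ε ^ 2)) ≤
            P.real {ω | (1 - ε) * (∫ ω', ellNorm p (Z ω') ∂P) ≤ ellNorm p (Z ω) ∧
              ellNorm p (Z ω) ≤ (1 + ε) * (∫ ω', ellNorm p (Z ω') ∂P)}) ∧
        (2 ≤ p → p < c * Real.log n →
          1 - C * Real.exp (-(c * min (p * (8 : ℝ) ^ (-p) * n * ε ^ 2)
              (p * (n : ℝ) ^ (2 / p) * ε ^ (2 / p)))) ≤
            P.real {ω | (1 - ε) * (∫ ω', ellNorm p (Z ω') ∂P) ≤ ellNorm p (Z ω) ∧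
              ellNorm p (Z ω) ≤ (1 + ε) * (∫ ω', ellNorm p (Z ω') ∂P)}) ∧
        (c * Real.log n ≤ p →
          1 - C * (n : ℝ) ^ (-(c * ε)) ≤
            P.real {ω | (1 - ε) * (∫ ω', ellNorm p (Z ω') ∂P) ≤ ellNorm p (Z ω) ∧
              ellNorm p (Z ω) ≤ (1 + ε) * (∫ ω', ellNorm p (Z ω') ∂P)}) := by
  refine ⟨8, Real.exp (-5) / 2048, by norm_num, by positivity, ?_⟩
  intro n hn p hp ε hε hε1 Ω _ P _ Z hZ
  obtain ⟨hint, heq⟩ := integrable_ellNorm_and_measureReal_eq hp ε hZ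
  have hη := exp_neg_five_lt
  have hη0 := Real.exp_pos (-5)
  have hn' : (1 : ℝ) ≤ n := by exact_mod_cast hn
  have hlog0 : 0 ≤ Real.log n := Real.log_nonneg hn'
  rw [heq]
  refine ⟨hint, fun hp2 => ?_, fun hp2 hpn => ?_, fun hpn => ?_⟩
  · refine le_trans ?_ (one_sub_le_measureReal_nearMean_of_le_two hp hp2 hn hε hε1)
    have h1 : Real.exp (-(Real.exp (-5) / 16 * n * ε ^ 2))
        ≤ Real.exp (-(Real.exp (-5) / 2048 * n * ε ^ 2)) := by
      refine Real.exp_le_exp.2 (neg_le_neg ?_)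
      gcongr
      norm_num
    linarith [Real.exp_pos (-(Real.exp (-5) / 2048 * n * ε ^ 2))]
  · refine le_trans ?_ (one_sub_le_measureReal_nearMean_of_lt_log hp2 hn (hpn.trans_le ?_) hε hε1)
    · set W := min (p * (8 : ℝ) ^ (-p) * n * ε ^ 2) (p * (n : ℝ) ^ (2 / p) * ε ^ (2 / p))
      have hW : 0 ≤ W := by positivity
      have h1 : Real.exp (-(Real.exp (-5) / 16 * W)) ≤ Real.exp (-(Real.exp (-5) / 2048 * W)) := by
        refine Real.exp_le_exp.2 (neg_le_neg ?_)
        gcongr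
        norm_num
      linarith [Real.exp_pos (-(Real.exp (-5) / 2048 * W))]
    · gcongr
      norm_num
  · have h := one_sub_le_measureReal_nearMean_of_const_mul_log_le hp hn hpn hε hε1
    rw [Real.rpow_def_of_pos (by linarith),
      show Real.log n * -(Real.exp (-5) / 2048 * ε)
        = -(Real.exp (-5) / 2048 * (ε * Real.log n)) by ring]
    exact h
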